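/- Let $K$ be a field and let $q\in K$ be nonzero and not a root of unity. For positive integers $m,n$, let $\mathcal O_q(M(m,n))$ be the $K$-algebra generated by $x_{ij}$ ($1\le i\le m$, $1\le j\le n$) subject to the relations \[ \begin{array}{ll} x_{ij}x_{il}=q\,x_{il}x_{ij} & (j<l),\\ x_{ij}x_{sj}=q\,x_{sj}x_{ij} & (i<s),\\ x_{ij}x_{sl}=x_{sl}x_{ij} & (s<i,\ j<l),\\ x_{ij}x_{sl}-x_{sl}x_{ij}=(q-q^{-1})\,x_{il}x_{sj} & (i<s,\ j<l). \end{array} \] For $1\le k\le n$ and a $k$-element subset $J=\{j_1<\dots<j_k\}$ of $\{1,\dots,n\}$, the quantum Plücker coordinate $[J]$ is the $k\times k$ quantum minor \[ [J]=\sum_{\sigma\in S_k}(-q)^{\ell(\sigma)}\,x_{1,j_{\sigma(1)}}x_{2,j_{\sigma(2)}}\cdots x_{k,j_{\sigma(k)}}\in\mathcal O_q(M(k,n)), \] where $\ell(\sigma)$ is the number of inversions of $\sigma$. The quantum grassmannian $\mathcal O_q(G(k,n))$ is the $K$-subalgebra of $\mathcal O_q(M(k,n))$ generated by the $k\times k$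 quantum minors, that is, by all $[J]$. Proposition. Let $1\le k<n$. There is an isomorphism of $K$-algebras $\mathcal O_q(G(k,n))\to\mathcal O_q(G(n-k,n))$ that sends, for every $k$-element subset $L$ of $\{1,\dots,n\}$, the quantum Plücker coordinate $[L]$ to the quantum Plücker coordinate $[w_0(\widehat L)]$, where $\widehat L=\{1,\dots,n\}\setminus L$ and $w_0$ is the permutation $i\mapsto n+1-i$ of $\{1,\dots,n\}$. -/

import Mathlib

/-- The defining relations of the algebra of `m × n` quantum matrices, imposed on the free algebra
on indeterminates `x i j`. Rows and columns are numbered from `0` instead of from `1`. -/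
inductive QMatrixRel {K : Type*} [Field K] (q : K) (m n : ℕ) :
    FreeAlgebra K (Fin m × Fin n) → FreeAlgebra K (Fin m × Fin n) → Prop
  | row (i : Fin m) (j l : Fin n) (h : j < l) :
      QMatrixRel q m n
        (FreeAlgebra.ι K (i, j) * FreeAlgebra.ι K (i, l))
        (q • (FreeAlgebra.ι K (i, l) * FreeAlgebra.ι K (i, j)))
  | col (i s : Fin m) (j : Fin n) (h : i < s) :
      QMatrixRel q m n
        (FreeAlgebra.ι K (i, j) * FreeAlgebra.ι K (s, j))
        (q • (FreeAlgebra.ι K (s, j) * FreeAlgebra.ι K (i, j)))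
  | anti (i s : Fin m) (j l : Fin n) (h : s < i) (h' : j < l) :
      QMatrixRel q m n
        (FreeAlgebra.ι K (i, j) * FreeAlgebra.ι K (s, l))
        (FreeAlgebra.ι K (s, l) * FreeAlgebra.ι K (i, j))
  | diag (i s : Fin m) (j l : Fin n) (h : i < s) (h' : j < l) :
      QMatrixRel q m n
        (FreeAlgebra.ι K (i, j) * FreeAlgebra.ι K (s, l)
          - FreeAlgebra.ι K (s, l) * FreeAlgebra.ι K (i, j))
        ((q - q⁻¹) • (FreeAlgebra.ι K (i, l) * FreeAlgebra.ι K (s, j)))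

/-- The algebra `O_q(M(m,n))` of `m × n` quantum matrices over `K`. -/
abbrev QMatrix {K : Type*} [Field K] (q : K) (m n : ℕ) : Type _ :=
  RingQuot (QMatrixRel q m n)

/-- The generator `x i j` of `O_q(M(m,n))`. -/
noncomputable def QMatrix.x {K : Type*} [Field K] (q : K) {m n : ℕ} (i : Fin m) (j : Fin n) :
    QMatrix q m n :=
  RingQuot.mkAlgHom K (QMatrixRel q m n) (FreeAlgebra.ι K (i, j))

/-- The length of a permutation of `{0, …, t-1}`: its number of inversions. -/
def permLength {t : ℕ} (σ : Equiv.Perm (Fin t)) : ℕ :=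
  (Finset.univ.filter fun p : Fin t × Fin t => p.1 < p.2 ∧ σ p.2 < σ p.1).card

/-- The quantum determinant `∑ σ, (-q)^(l(σ)) a_{1σ(1)} ⋯ a_{tσ(t)}` of a `t × t` array of elements
of a `K`-algebra; the factors are multiplied in the order of the rows. -/
noncomputable def quantumDet {K : Type*} [Field K] (q : K) {A : Type*} [Ring A] [Algebra K A]
    {t : ℕ} (a : Fin t → Fin t → A) : A :=
  ∑ σ : Equiv.Perm (Fin t), (-q) ^ permLength σ • (List.ofFn fun i => a i (σ i)).prod

/-- The quantum minor `[I ∣ J]` of `O_q(M(m,n))` with rows `I` and columns `J`, where `I` and `J`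
have `t` elements, which are listed in increasing order. -/
noncomputable def quantumMinor {K : Type*} [Field K] (q : K) {m n t : ℕ}
    (I : Finset (Fin m)) (J : Finset (Fin n)) (hI : I.card = t) (hJ : J.card = t) :
    QMatrix q m n :=
  quantumDet q fun a b => QMatrix.x q (I.orderEmbOfFin hI a) (J.orderEmbOfFin hJ b)

/-- The quantum grassmannian `O_q(G(k,n))`: the subalgebra of `O_q(M(k,n))` generated by the
`k × k` quantum minors. -/
noncomputable def quantumGrassmannian {K : Type*} [Field K] (q : K) (k n : ℕ) :
    Subalgebra K (QMatrix q k n) :=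
  Algebra.adjoin K {a | ∃ (I : Finset (Fin k)) (J : Finset (Fin n)) (hI : I.card = k)
    (hJ : J.card = k), a = quantumMinor q I J hI hJ}

/-- The quantum Plücker coordinate `[J] = [1, …, k ∣ J]`, as an element of `O_q(G(k,n))`. -/
noncomputable def quantumPlucker {K : Type*} [Field K] (q : K) {k n : ℕ}
    (J : Finset (Fin n)) (hJ : J.card = k) : quantumGrassmannian q k n :=
  ⟨quantumMinor q Finset.univ J (Finset.card_fin k) hJ,
    Algebra.subset_adjoin ⟨Finset.univ, J, Finset.card_fin k, hJ, rfl⟩⟩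

/-- The image `w₀(L̂)` of the complement of `L` in the index set under the permutation `w₀` that
reverses the order of the index set. -/
def revCompl {n : ℕ} (L : Finset (Fin n)) : Finset (Fin n) :=
  Lᶜ.map Fin.revPerm.toEmbedding

theorem card_revCompl {n k : ℕ} {L : Finset (Fin n)} (hL : L.card = k) :
    (revCompl L).card = n - k := by
  simp [revCompl, Finset.card_compl, hL]

/-!
Let `X` be the generic `n × n` quantum matrix and `D` its quantum determinant. Put `m = n - k`.
The isomorphism comes from the inverse matrix of `X`: its `k × k` minors are, up to sign and powers
of `q` and `D`, the complementary `m × m` minors of `X`.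

*Expansions.* For every tuple `r` of row indices, `∑ c, ε(c) x_{r₁c₁} ⋯ x_{rₙcₙ} = ε(r) D`, where
the quantum sign `ε` of a tuple is `(-q)` to its number of inversions, or `0` if an entry is repeated
(`sum_qSign_prod`, proved by sorting `r`). Splitting off one factor gives the Laplace expansions,
hence an adjugate `Y` with `X Y = Y X = D` (`exists_adjugate`), which forces `D` to be central.
Multiplying the identity on the left by words in the entries of `Y` cancels the first `k` factors,
which is the quantum Jacobi identity `quantumDet_mul_adjugate_minor`.

*The inverse is quantum.* The defining relations say that `X ⊗ X` commutes with the `R`-matrix.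
Inverting, `Y` satisfies the same relations over the opposite algebra; reversing the order of the
indices and transposing makes it a quantum matrix `Z` (`IsQuantumMatrix.op_of_adjugate`,
`IsQuantumMatrix.rev_of_op`). So there is an algebra map from `O_q(M(k,n))` which sends the generators
to rescaled entries of `Z`, and `[L]` to `D ^ (k - 1) [w₀(L̂)]` (`quantumDet_mul_rev_adjugate`).

*Removing `D`.* Let `t` be a new central variable, which keeps track of degrees. Scaling the first row
of the generic `m × n` matrix by `D ^ (k - 1) t` gives a second algebra map, which sends `[M]` to
`D ^ (k - 1) [M] t`. It is injective because `D` is regular. Multiplying the first row in the map above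
by `t` as well, the image of `[L]` is that of `[w₀(L̂)]` under the second map, and so the map
`[L] ↦ [w₀(L̂)]` is well defined (`exists_quantumGrassmannian_algHom`). The same map with `k` and `m`
interchanged is its inverse, as `L ↦ w₀(L̂)` is an involution.

*Regularity of `D`.* `O_q(M(m,n))` has no zero divisors (`QMatrix.noZeroDivisors`), because adjoining
the generators one at a time, in the order of reading, is an iterated Ore extension. The skew
derivation in each step is obtained from an algebra map into triangular `2 × 2` matrices
(`IsPartialQuantumMatrix.triangular`), and the Ore extension is realized by operators on sequences of
coefficients (`noZeroDivisors_of_ore`).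
-/

/-! ### Inversions, quantum signs and row expansions -/

section Words

variable {A : Type*} [Monoid A]

/-- The product of a word as a function of two neighbouring letters. -/
theorem exists_prod_ofFn_update {t : ℕ} (g : Fin t → A) (a : Fin t) (h : a.val + 1 < t) :
    ∃ u v : A, ∀ y z : A,
      (List.ofFn (Function.update (Function.update g a y) ⟨a + 1, h⟩ z)).prod
        = u * (y * z) * v := by
  induction t with
  | zero => exact a.elim0
  | succ t ih =>
    induction a using Fin.cases with
    | zero =>
      obtain ⟨t, rfl⟩ : ∃ t', t = t' + 1 := ⟨t - 1, by simp at h; omega⟩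
      refine ⟨1, (List.ofFn fun i : Fin t => g i.succ.succ).prod, fun y z => ?_⟩
      have h1 : (⟨(0 : Fin (t + 1 + 1)).val + 1, h⟩ : Fin (t + 1 + 1)) = Fin.succ 0 := by
        ext; simp
      rw [h1, List.ofFn_succ, List.ofFn_succ]
      have h2 : ∀ i : Fin t, i.succ.succ ≠ 1 := fun i => by simp [Fin.ext_iff]
      simp [mul_assoc, h2]
    | succ b =>
      obtain ⟨u, v, huv⟩ := ih (fun i => g i.succ) b (by simpa using h)
      refine ⟨g 0 * u, v, fun y z => ?_⟩
      rw [List.ofFn_succ, List.prod_cons]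
      have h1 : (⟨b.succ.val + 1, h⟩ : Fin (t + 1)) = Fin.succ ⟨b + 1, by simpa using h⟩ := by
        ext; simp
      have h2 := huv y z
      rw [h1]
      have h3 : (fun i : Fin t => Function.update (Function.update g b.succ y)
          (Fin.succ ⟨b + 1, by simpa using h⟩) z i.succ)
          = Function.update (Function.update (fun i => g i.succ) b y)
            ⟨b + 1, by simpa using h⟩ z := by
        funext i
        simp only [Function.update_apply, Fin.succ_inj]
      rw [h3, h2]
      simp [mul_assoc, (Fin.succ_ne_zero _).symm]

end Words

section Inversions

variable {t n : ℕ}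

/-- The number of inversions of a tuple `c`. -/
def invCount (c : Fin t → Fin n) : ℕ :=
  (Finset.univ.filter fun p : Fin t × Fin t => p.1 < p.2 ∧ c p.2 < c p.1).card

theorem permLength_eq_invCount (σ : Equiv.Perm (Fin t)) : permLength σ = invCount σ := rfl

/-- Exchanging two neighbours inverts the order of no other pair. -/
theorem swap_lt_swap_or {a : Fin t} (h : a.val + 1 < t) {i j : Fin t} (hij : i < j) :
    Equiv.swap a ⟨a + 1, h⟩ i < Equiv.swap a ⟨a + 1, h⟩ j ∨ (i = a ∧ j = ⟨a + 1, h⟩) := by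
  simp only [Equiv.swap_apply_def, Fin.lt_def, Fin.ext_iff] at *
  have hb : (⟨a + 1, h⟩ : Fin t).val = a + 1 := rfl
  split_ifs <;> omega

theorem invCount_comp_swap (c : Fin t → Fin n) (a : Fin t) (h : a.val + 1 < t)
    (hc : c a < c ⟨a + 1, h⟩) :
    invCount (c ∘ Equiv.swap a ⟨a + 1, h⟩) = invCount c + 1 := by
  set b : Fin t := ⟨a + 1, h⟩ with hb
  set s := Equiv.swap a b with hs
  have hab : a < b := by simp [hb, Fin.lt_def]
  have key : ∀ i j : Fin t, i < j → s i < s j ∨ (i = a ∧ j = b) := by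
    intro i j hij
    exact swap_lt_swap_or h hij
  have hset : (Finset.univ.filter fun p : Fin t × Fin t =>
        p.1 < p.2 ∧ (c ∘ s) p.2 < (c ∘ s) p.1)
      = insert (a, b) ((Finset.univ.filter fun p : Fin t × Fin t =>
        p.1 < p.2 ∧ c p.2 < c p.1).map (s.prodCongr s).toEmbedding) := by
    ext ⟨i, j⟩
    simp only [Finset.mem_filter, Finset.mem_univ, true_and, Function.comp, Finset.mem_insert,
      Finset.mem_map_equiv, Prod.mk.injEq]
    have e : ∀ x : Fin t × Fin t, (s.prodCongr s).symm x = (s x.1, s x.2) := by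
      intro x; simp [hs, Equiv.prodCongr, Prod.map]
    rw [e]
    constructor
    · rintro ⟨hij, hlt⟩
      rcases key i j hij with h1 | h1
      · exact Or.inr ⟨h1, hlt⟩
      · exact Or.inl h1
    · rintro (⟨rfl, rfl⟩ | ⟨h1, h2⟩)
      · refine ⟨hab, ?_⟩
        simpa [hs] using hc
      · refine ⟨?_, h2⟩
        rcases key _ _ h1 with h3 | ⟨h3, h4⟩
        · simpa [hs] using h3
        · exfalso
          simp only at h2 h3 h4
          rw [h3, h4] at h2
          exact absurd h2 (not_lt.2 hc.le)
  unfold invCount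
  rw [hset, Finset.card_insert_of_notMem, Finset.card_map]
  simp only [Finset.mem_map_equiv, Finset.mem_filter, not_and, not_lt]
  intro _ h1
  exfalso
  have e : (s.prodCongr s).symm (a, b) = (b, a) := by simp [hs]
  rw [e] at h1
  exact absurd h1 (not_lt.2 hab.le)

theorem invCount_comp_swap' (c : Fin t → Fin n) (a : Fin t) (h : a.val + 1 < t)
    (hc : c ⟨a + 1, h⟩ < c a) :
    invCount c = invCount (c ∘ Equiv.swap a ⟨a + 1, h⟩) + 1 := by
  rw [← invCount_comp_swap (c ∘ Equiv.swap a ⟨a + 1, h⟩) a h (by simpa using hc)]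
  congr 1
  funext i; simp

/-- A tuple which is not strictly increasing has a weak descent at some pair of neighbours. -/
theorem exists_le_of_not_strictMono {c : Fin t → Fin n} (hc : ¬ StrictMono c) :
    ∃ (a : Fin t) (h : a.val + 1 < t), c ⟨a + 1, h⟩ ≤ c a := by
  by_contra! H
  apply hc
  cases t with
  | zero => exact fun a => a.elim0
  | succ t =>
    rw [Fin.strictMono_iff_lt_succ]
    intro i
    exact H i.castSucc (by simp)

variable {K : Type*} [Field K] (q : K)

/-- The quantum sign of a tuple `c`: it is `(-q)` to the number of inversions of `c` if the entries
are distinct, and `0` otherwise. -/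
noncomputable def qSign (c : Fin t → Fin n) : K :=
  open Classical in if Function.Injective c then (-q) ^ invCount c else 0

variable {q}

theorem qSign_of_injective {c : Fin t → Fin n} (hc : Function.Injective c) :
    qSign q c = (-q) ^ invCount c := by simp [qSign, hc]

theorem qSign_of_not_injective {c : Fin t → Fin n} (hc : ¬ Function.Injective c) :
    qSign q c = 0 := by simp [qSign, hc]

theorem qSign_comp_swap (c : Fin t → Fin n) (a : Fin t) (h : a.val + 1 < t)
    (hc : c a < c ⟨a + 1, h⟩) :
    qSign q (c ∘ Equiv.swap a ⟨a + 1, h⟩) = -q * qSign q c := by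
  by_cases hi : Function.Injective c
  · rw [qSign_of_injective hi, qSign_of_injective (hi.comp (Equiv.injective _)),
      invCount_comp_swap c a h hc, pow_succ']
  · rw [qSign_of_not_injective hi, qSign_of_not_injective, mul_zero]
    rwa [Equiv.injective_comp]

theorem invCount_of_strictMono {c : Fin t → Fin n} (hc : StrictMono c) : invCount c = 0 := by
  simp only [invCount, Finset.card_eq_zero, Finset.filter_eq_empty_iff]
  rintro ⟨i, j⟩ - ⟨h1, h2⟩
  exact absurd (hc h1) (not_lt.2 h2.le)

theorem qSign_of_strictMono {c : Fin t → Fin n} (hc : StrictMono c) : qSign q c = 1 := by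
  rw [qSign_of_injective hc.injective, invCount_of_strictMono hc, pow_zero]

end Inversions

/-- The array `x` of elements of a `K`-algebra satisfies the defining relations of quantum
matrices. -/
structure IsQuantumMatrix {K : Type*} [Field K] (q : K) {A : Type*} [Ring A] [Algebra K A]
    {ι κ : Type*} [LT ι] [LT κ] (x : ι → κ → A) : Prop where
  row : ∀ i j l, j < l → x i j * x i l = q • (x i l * x i j)
  col : ∀ i s j, i < s → x i j * x s j = q • (x s j * x i j)
  anti : ∀ i s j l, s < i → j < l → x i j * x s l = x s l * x i j
  diag : ∀ i s j l, i < s → j < l →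
    x i j * x s l - x s l * x i j = (q - q⁻¹) • (x i l * x s j)

namespace IsQuantumMatrix

variable {K : Type*} [Field K] {q : K} {A : Type*} [Ring A] [Algebra K A]

theorem submatrix {ι κ ι' κ' : Type*} [LT ι] [LT κ] [LT ι'] [LT κ'] {x : ι → κ → A}
    (hx : IsQuantumMatrix q x) {f : ι' → ι} {g : κ' → κ} (hf : ∀ a b, a < b → f a < f b)
    (hg : ∀ a b, a < b → g a < g b) : IsQuantumMatrix q fun i j => x (f i) (g j) where
  row _ _ _ h := hx.row _ _ _ (hg _ _ h)
  col _ _ _ h := hx.col _ _ _ (hf _ _ h)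
  anti _ _ _ _ h h' := hx.anti _ _ _ _ (hf _ _ h) (hg _ _ h')
  diag _ _ _ _ h h' := hx.diag _ _ _ _ (hf _ _ h) (hg _ _ h')

theorem transpose {ι κ : Type*} [LT ι] [LT κ] {x : ι → κ → A}
    (hx : IsQuantumMatrix q x) : IsQuantumMatrix q fun i j => x j i where
  row _ _ _ h := hx.col _ _ _ h
  col _ _ _ h := hx.row _ _ _ h
  anti _ _ _ _ h h' := (hx.anti _ _ _ _ h' h).symm
  diag i s j l h h' := by rw [hx.diag _ _ _ _ h' h, hx.anti _ _ _ _ h' h]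

theorem map {ι κ : Type*} [LT ι] [LT κ] {x : ι → κ → A} (hx : IsQuantumMatrix q x)
    {B : Type*} [Ring B] [Algebra K B] (f : A →ₐ[K] B) :
    IsQuantumMatrix q fun i j => f (x i j) where
  row _ _ _ h := by rw [← map_mul, hx.row _ _ _ h, map_smul, map_mul]
  col _ _ _ h := by rw [← map_mul, hx.col _ _ _ h, map_smul, map_mul]
  anti _ _ _ _ h h' := by rw [← map_mul, hx.anti _ _ _ _ h h', map_mul]
  diag _ _ _ _ h h' := by
    rw [← map_mul, ← map_mul, ← map_sub, hx.diag _ _ _ _ h h', map_smul, map_mul]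

end IsQuantumMatrix

section TupleSums

variable {K : Type*} [Field K] {q : K} {A : Type*} [Ring A] [Algebra K A]

/-- Exchanging the entries of `r`, of `c`, or of both at the neighbouring positions `a` and `a + 1`
changes only two neighbouring factors of the word `x_{r₁c₁} ⋯ x_{rₜcₜ}`. -/
theorem exists_prod_ofFn_comp_swap {m n t : ℕ} (x : Fin m → Fin n → A) (r : Fin t → Fin m)
    (c : Fin t → Fin n) (a : Fin t) (h : a.val + 1 < t) :
    ∃ u v : A,
      (List.ofFn fun i => x (r i) (c i)).prod
        = u * (x (r a) (c a) * x (r ⟨a + 1, h⟩) (c ⟨a + 1, h⟩)) * v ∧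
      (List.ofFn fun i => x (r i) ((c ∘ Equiv.swap a ⟨a + 1, h⟩) i)).prod
        = u * (x (r a) (c ⟨a + 1, h⟩) * x (r ⟨a + 1, h⟩) (c a)) * v ∧
      (List.ofFn fun i => x ((r ∘ Equiv.swap a ⟨a + 1, h⟩) i) (c i)).prod
        = u * (x (r ⟨a + 1, h⟩) (c a) * x (r a) (c ⟨a + 1, h⟩)) * v ∧
      (List.ofFn fun i => x ((r ∘ Equiv.swap a ⟨a + 1, h⟩) i)
          ((c ∘ Equiv.swap a ⟨a + 1, h⟩) i)).prod
        = u * (x (r ⟨a + 1, h⟩) (c ⟨a + 1, h⟩) * x (r a) (c a)) * v := by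
  obtain ⟨u, v, huv⟩ := exists_prod_ofFn_update (fun i => x (r i) (c i)) a h
  have hne : (⟨a + 1, h⟩ : Fin t) ≠ a := by simp [Fin.ext_iff]
  refine ⟨u, v, ?_, ?_, ?_, ?_⟩ <;> rw [← huv] <;> congr 2 <;> funext i <;>
    by_cases h1 : i = a <;> by_cases h2 : i = ⟨a + 1, h⟩ <;>
    simp_all [Equiv.swap_apply_def]

variable {m n t : ℕ} {x : Fin m → Fin n → A}

/-- A row expansion with two equal neighbouring rows vanishes: the terms of `c` and of `c` with the
two neighbours exchanged cancel. -/
theorem sum_qSign_prod_eq_zero (hx : IsQuantumMatrix q x) (r : Fin t → Fin m) (a : Fin t)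
    (h : a.val + 1 < t) (hr : r a = r ⟨a + 1, h⟩) :
    ∑ c : Fin t → Fin n, qSign q c • (List.ofFn fun i => x (r i) (c i)).prod = 0 := by
  have hne : a ≠ (⟨a + 1, h⟩ : Fin t) := by simp [Fin.ext_iff]
  have main : ∀ c : Fin t → Fin n, c a < c ⟨a + 1, h⟩ →
      qSign q c • (List.ofFn fun i => x (r i) (c i)).prod +
      qSign q (c ∘ Equiv.swap a ⟨a + 1, h⟩) •
        (List.ofFn fun i => x (r i) ((c ∘ Equiv.swap a ⟨a + 1, h⟩) i)).prod = 0 := by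
    intro c hc
    obtain ⟨u, v, h1, h2, -, -⟩ := exists_prod_ofFn_comp_swap x r c a h
    rw [qSign_comp_swap c a h hc, h1, h2, hr, hx.row _ _ _ hc]
    simp only [mul_smul_comm, smul_mul_assoc]
    module
  refine Finset.sum_involution (fun c _ => c ∘ Equiv.swap a ⟨a + 1, h⟩) ?_ ?_ ?_ ?_
  · intro c _
    rcases lt_trichotomy (c a) (c ⟨a + 1, h⟩) with hc | hc | hc
    · exact main c hc
    · rw [qSign_of_not_injective (fun hi => hne (hi hc)), qSign_of_not_injective, zero_smul,
        zero_smul, add_zero]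
      rw [Equiv.injective_comp]
      exact fun hi => hne (hi hc)
    · have := main (c ∘ Equiv.swap a ⟨a + 1, h⟩) (by simpa using hc)
      rw [add_comm]
      have e : (c ∘ Equiv.swap a ⟨a + 1, h⟩) ∘ Equiv.swap a ⟨a + 1, h⟩ = c := by
        funext i; simp
      rwa [e] at this
  · intro c _ hc hcs
    apply hc
    rw [qSign_of_not_injective, zero_smul]
    intro hi
    have := congrFun hcs a
    simp only [Function.comp, Equiv.swap_apply_left] at this
    exact hne (hi this).symm
  · simp
  · intro c _
    funext i; simp

/-- Exchanging two neighbouring rows multiplies the row expansion by `-q`; the terms are paired as in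
`sum_qSign_prod_eq_zero`. -/
theorem sum_qSign_prod_comp_swap (hq : q ≠ 0) (hx : IsQuantumMatrix q x) (r : Fin t → Fin m)
    (a : Fin t) (h : a.val + 1 < t) (hr : r a < r ⟨a + 1, h⟩) :
    ∑ c : Fin t → Fin n,
      qSign q c • (List.ofFn fun i => x ((r ∘ Equiv.swap a ⟨a + 1, h⟩) i) (c i)).prod
    = -q • ∑ c : Fin t → Fin n, qSign q c • (List.ofFn fun i => x (r i) (c i)).prod := by
  have hne : a ≠ (⟨a + 1, h⟩ : Fin t) := by simp [Fin.ext_iff]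
  rw [← sub_eq_zero, Finset.smul_sum, ← Finset.sum_sub_distrib]
  have main : ∀ c : Fin t → Fin n, c a < c ⟨a + 1, h⟩ →
      (qSign q c • (List.ofFn fun i => x ((r ∘ Equiv.swap a ⟨a + 1, h⟩) i) (c i)).prod
        - -q • qSign q c • (List.ofFn fun i => x (r i) (c i)).prod) +
      (qSign q (c ∘ Equiv.swap a ⟨a + 1, h⟩) •
        (List.ofFn fun i => x ((r ∘ Equiv.swap a ⟨a + 1, h⟩) i)
          ((c ∘ Equiv.swap a ⟨a + 1, h⟩) i)).prod
        - -q • qSign q (c ∘ Equiv.swap a ⟨a + 1, h⟩) •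
        (List.ofFn fun i => x (r i) ((c ∘ Equiv.swap a ⟨a + 1, h⟩) i)).prod) = 0 := by
    intro c hc
    obtain ⟨u, v, h1, h2, h3, h4⟩ := exists_prod_ofFn_comp_swap x r c a h
    have hd := hx.diag _ _ _ _ hr hc
    rw [sub_eq_iff_eq_add] at hd
    rw [qSign_comp_swap c a h hc, h1, h2, h3, h4, hd, hx.anti _ _ _ _ hr hc]
    simp only [mul_smul_comm, smul_mul_assoc, mul_add, add_mul]
    match_scalars
    · field_simp
      ring
    · ring
  refine Finset.sum_involution (fun c _ => c ∘ Equiv.swap a ⟨a + 1, h⟩) ?_ ?_ ?_ ?_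
  · intro c _
    rcases lt_trichotomy (c a) (c ⟨a + 1, h⟩) with hc | hc | hc
    · exact main c hc
    · have hi : ¬ Function.Injective c := fun hi => hne (hi hc)
      have hi' : ¬ Function.Injective (c ∘ Equiv.swap a ⟨a + 1, h⟩) := by
        rwa [Equiv.injective_comp]
      simp only [qSign_of_not_injective hi, qSign_of_not_injective hi', zero_smul, smul_zero,
        sub_zero, add_zero]
    · have := main (c ∘ Equiv.swap a ⟨a + 1, h⟩) (by simpa using hc)
      rw [add_comm]
      have e : (c ∘ Equiv.swap a ⟨a + 1, h⟩) ∘ Equiv.swap a ⟨a + 1, h⟩ = c := by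
        funext i; simp
      rwa [e] at this
  · intro c _ hc hcs
    apply hc
    rw [qSign_of_not_injective]
    · simp
    intro hi
    have := congrFun hcs a
    simp only [Function.comp, Equiv.swap_apply_left] at this
    exact hne (hi this).symm
  · simp
  · intro c _
    funext i; simp

/-- A sum over tuples weighted with their quantum signs is a sum over permutations. -/
theorem sum_qSign_smul {n : ℕ} (f : (Fin n → Fin n) → A) :
    ∑ c : Fin n → Fin n, qSign q c • f c
      = ∑ σ : Equiv.Perm (Fin n), (-q) ^ permLength σ • f σ := by
  classical
  symm
  refine Finset.sum_of_injOn (fun σ : Equiv.Perm (Fin n) => (σ : Fin n → Fin n))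
    (fun _ _ _ _ h => DFunLike.coe_injective h) (by simp) ?_ ?_
  · intro c _ hc
    rw [qSign_of_not_injective, zero_smul]
    intro hi
    exact hc ⟨Equiv.ofBijective c (Finite.injective_iff_bijective.1 hi), by simp, rfl⟩
  · intro σ _
    rw [qSign_of_injective σ.injective, permLength_eq_invCount]

/-- The row expansion of the quantum determinant for an arbitrary tuple of rows. The tuple is sorted
by exchanging neighbours. -/
theorem sum_qSign_prod {t n : ℕ} (htn : t = n) {x : Fin n → Fin n → A} (hq : q ≠ 0)
    (hx : IsQuantumMatrix q x) (r : Fin t → Fin n) :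
    ∑ c : Fin t → Fin n, qSign q c • (List.ofFn fun i => x (r i) (c i)).prod
      = qSign q r • quantumDet q x := by
  subst htn
  induction hN : invCount r using Nat.strong_induction_on generalizing r with
  | _ N ih =>
  by_cases hr : StrictMono r
  · have hid : r = id := by
      refine (hr.range_inj strictMono_id).1 ?_
      rw [Set.range_id, (Finite.injective_iff_surjective.1 hr.injective).range_eq]
    rw [qSign_of_strictMono hr, one_smul, sum_qSign_smul, hid, quantumDet]
    rfl
  · obtain ⟨a, h, har⟩ := exists_le_of_not_strictMono hr
    rcases har.eq_or_lt with har | har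
    · rw [sum_qSign_prod_eq_zero hx r a h har.symm, qSign_of_not_injective, zero_smul]
      intro hi
      have := hi har
      simp [Fin.ext_iff] at this
    · set r' := r ∘ Equiv.swap a ⟨a + 1, h⟩ with hr'
      have e : r = r' ∘ Equiv.swap a ⟨a + 1, h⟩ := by funext i; simp [hr']
      have hlt : r' a < r' ⟨a + 1, h⟩ := by simpa [hr'] using har
      have hinv := invCount_comp_swap r' a h hlt
      rw [← e] at hinv
      have h1 := sum_qSign_prod_comp_swap hq hx r' a h hlt
      have h2 := qSign_comp_swap (q := q) r' a h hlt
      rw [← e] at h1 h2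
      rw [h1, h2, ih (invCount r') (by omega) r' rfl, smul_smul]

end TupleSums

section Transpose

variable {K : Type*} [Field K] {q : K} {A : Type*} [Ring A] [Algebra K A]

/-- A word with the columns in the order of `c` may be sorted by columns: the neighbours that have to
be exchanged lie in antidiagonal position, and so they commute. -/
theorem prod_ofFn_eq_prod_ofFn_symm {n : ℕ} {x : Fin n → Fin n → A} (hx : IsQuantumMatrix q x)
    (c r : Equiv.Perm (Fin n)) (hcr : ∀ a b, a < b → c b < c a → r a < r b) :
    (List.ofFn fun i => x (r i) (c i)).prod = (List.ofFn fun i => x (r (c.symm i)) i).prod := by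
  induction hN : invCount c using Nat.strong_induction_on generalizing c r with
  | _ N ih =>
  by_cases hc : StrictMono c
  · have hid : c = 1 := by
      ext1 i
      exact congrFun ((hc.range_inj strictMono_id).1 (by
        rw [Set.range_id, c.surjective.range_eq])) i
    subst hid
    rfl
  · obtain ⟨a, h, hac⟩ := exists_le_of_not_strictMono hc
    have hne : a ≠ (⟨a + 1, h⟩ : Fin n) := by simp [Fin.ext_iff]
    have hac : c ⟨a + 1, h⟩ < c a := lt_of_le_of_ne hac fun e => hne (c.injective e).symm
    have hra : r a < r ⟨a + 1, h⟩ := hcr _ _ (by simp [Fin.lt_def]) hac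
    set s := Equiv.swap a (⟨a + 1, h⟩ : Fin n) with hs
    obtain ⟨u, v, h1, -, -, h4⟩ := exists_prod_ofFn_comp_swap x r c a h
    have h5 : (List.ofFn fun i => x (r i) (c i)).prod
        = (List.ofFn fun i => x ((r ∘ s) i) ((c ∘ s) i)).prod := by
      rw [h1, h4, hx.anti _ _ _ _ hra hac]
    have hinv := invCount_comp_swap' c a h hac
    have h6 := ih (invCount (s.trans c)) (by
      have : (⇑(s.trans c)) = c ∘ s := rfl
      rw [this, ← hN, hinv]; exact Nat.lt_succ_self _) (s.trans c) (s.trans r) (by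
        intro i j hij hlt
        simp only [Equiv.trans_apply] at hlt ⊢
        rcases swap_lt_swap_or h hij with h7 | ⟨rfl, rfl⟩
        · exact hcr _ _ h7 hlt
        · simp only [hs, Equiv.swap_apply_left, Equiv.swap_apply_right] at hlt
          exact absurd hlt (not_lt.2 hac.le)) rfl
    rw [h5]
    refine Eq.trans h6 ?_
    simp [hs]

theorem invCount_symm {n : ℕ} (σ : Equiv.Perm (Fin n)) : invCount σ.symm = invCount σ := by
  unfold invCount
  refine Finset.card_bij' (fun p _ => (σ.symm p.2, σ.symm p.1)) (fun p _ => (σ p.2, σ p.1))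
    ?_ ?_ ?_ ?_ <;> simp +contextual

/-- A quantum determinant may be expanded along the columns instead of along the rows. -/
theorem quantumDet_transpose {n : ℕ} {x : Fin n → Fin n → A} (hx : IsQuantumMatrix q x) :
    quantumDet q (fun i j => x j i) = quantumDet q x := by
  unfold quantumDet
  refine Fintype.sum_equiv (Equiv.inv (Equiv.Perm (Fin n))) _ _ fun σ => ?_
  have h1 := prod_ofFn_eq_prod_ofFn_symm hx σ.symm 1 (fun a b h _ => h)
  simp only [Equiv.Perm.one_apply, Equiv.symm_symm] at h1
  rw [← h1, permLength_eq_invCount, permLength_eq_invCount, ← invCount_symm]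
  rfl

end Transpose

/-! ### Laplace expansions, the adjugate and the Jacobi identity -/

section Append

variable {k m N : ℕ}

/-- The number of inversions between the entries of `b` and the entries of `c` in the tuple
consisting of `b` followed by `c`. -/
def crossCount (b : Fin k → Fin N) (c : Fin m → Fin N) : ℕ :=
  (Finset.univ.filter fun p : Fin k × Fin m => c p.2 < b p.1).card

theorem invCount_append (b : Fin k → Fin N) (c : Fin m → Fin N) :
    invCount (Fin.append b c) = invCount b + invCount c + crossCount b c := by
  have h1 : ∀ (i : Fin k) (j : Fin m), Fin.castAdd m i < Fin.natAdd k j := fun i j => by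
    simp only [Fin.lt_def, Fin.val_castAdd, Fin.val_natAdd]; omega
  have h2 : ∀ (i : Fin k) (j : Fin m), ¬ Fin.natAdd k j < Fin.castAdd m i := fun i j =>
    not_lt.2 (h1 i j).le
  have h3 : ∀ i j : Fin k, Fin.castAdd m i < Fin.castAdd m j ↔ i < j := fun i j => Iff.rfl
  simp only [invCount, crossCount, Finset.card_filter, Fintype.sum_prod_type, Fin.sum_univ_add,
    Fin.append_left, Fin.append_right, Finset.sum_add_distrib, h1, h2, true_and, false_and,
    if_false, h3, Fin.natAdd_lt_natAdd_iff]
  simp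
  omega

theorem invCount_comp_perm_of_strictMono {e : Fin m → Fin N} (he : StrictMono e)
    (σ : Equiv.Perm (Fin m)) : invCount (e ∘ σ) = permLength σ := by
  simp [invCount, permLength, he.lt_iff_lt]

theorem crossCount_comp_perm_right (b : Fin k → Fin N) (e : Fin m → Fin N)
    (σ : Equiv.Perm (Fin m)) : crossCount b (e ∘ σ) = crossCount b e := by
  simp only [crossCount, Finset.card_filter, Fintype.sum_prod_type, Function.comp]
  exact Finset.sum_congr rfl fun i _ =>
    Equiv.sum_comp σ fun j => if e j < b i then 1 else 0

theorem crossCount_comp_perm_left (b : Fin k → Fin N) (e : Fin m → Fin N)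
    (σ : Equiv.Perm (Fin k)) : crossCount (b ∘ σ) e = crossCount b e := by
  simp only [crossCount, Finset.card_filter, Fintype.sum_prod_type, Function.comp]
  exact Equiv.sum_comp σ fun i => ∑ j, if e j < b i then 1 else 0

theorem crossCount_add_crossCount {b : Fin k → Fin N} {e : Fin m → Fin N}
    (hbe : ∀ i j, b i ≠ e j) : crossCount b e + crossCount e b = k * m := by
  have h : crossCount e b
      = (Finset.univ.filter fun p : Fin k × Fin m => ¬ e p.2 < b p.1).card := by
    unfold crossCount
    refine Finset.card_equiv (Equiv.prodComm _ _) ?_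
    rintro ⟨i, j⟩
    have := hbe j i
    simp [le_iff_lt_or_eq, this]
  rw [h, crossCount, Finset.card_filter_add_card_filter_not]
  simp

/-- Complementary strictly increasing tuples: the entry `b i` exceeds `b i` indices altogether, of
which `i` belong to `b`. -/
theorem crossCount_add_sum {b : Fin k → Fin N} (hb : StrictMono b) {e : Fin m → Fin N}
    (he : StrictMono e) (hbe : ∀ y, y ∈ Set.range e ↔ y ∉ Set.range b) :
    crossCount b e + ∑ i : Fin k, (i : ℕ) = ∑ i, (b i : ℕ) := by
  simp only [crossCount, Finset.card_filter, Fintype.sum_prod_type]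
  rw [← Finset.sum_add_distrib]
  refine Finset.sum_congr rfl fun i _ => ?_
  rw [← Finset.card_filter]
  have h1 : Finset.Iio (b i) = (Finset.univ.filter fun j => e j < b i).map ⟨e, he.injective⟩
      ∪ (Finset.Iio i).map ⟨b, hb.injective⟩ := by
    ext y
    simp only [Finset.mem_Iio, Finset.mem_union, Finset.mem_map, Finset.mem_filter,
      Finset.mem_univ, true_and, Function.Embedding.coeFn_mk]
    constructor
    · intro hy
      by_cases hyb : y ∈ Set.range b
      · obtain ⟨j, rfl⟩ := hyb
        exact Or.inr ⟨j, hb.lt_iff_lt.1 hy, rfl⟩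
      · obtain ⟨j, rfl⟩ := (hbe y).2 hyb
        exact Or.inl ⟨j, hy, rfl⟩
    · rintro (⟨j, hj, rfl⟩ | ⟨j, hj, rfl⟩)
      · exact hj
      · exact hb hj
  have h2 := congrArg Finset.card h1
  rw [Fin.card_Iio, Finset.card_union_of_disjoint, Finset.card_map, Finset.card_map,
    Fin.card_Iio] at h2
  · exact h2.symm
  · rw [Finset.disjoint_left]
    intro y hy1 hy2
    simp only [Finset.mem_map, Function.Embedding.coeFn_mk] at hy1 hy2
    obtain ⟨j, -, rfl⟩ := hy1
    obtain ⟨j', -, h⟩ := hy2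
    exact (hbe (e j)).1 ⟨j, rfl⟩ ⟨j', h⟩

theorem append_injective {b : Fin k → Fin N} {e : Fin m → Fin N} (hb : b.Injective)
    (he : e.Injective) (hbe : ∀ i j, b i ≠ e j) : (Fin.append b e).Injective :=
  Fin.append_injective_iff.2 ⟨hb, he, hbe⟩

theorem injective_of_append {b : Fin k → Fin N} {c : Fin m → Fin N}
    (h : (Fin.append b c).Injective) : b.Injective ∧ c.Injective ∧ ∀ i j, b i ≠ c j :=
  Fin.append_injective_iff.1 h

/-- An injective tuple with values in the range of an injective tuple is a rearrangement of it. -/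
theorem exists_perm_comp_eq {e c : Fin m → Fin N} (hc : c.Injective)
    (h : ∀ i, c i ∈ Set.range e) : ∃ σ : Equiv.Perm (Fin m), e ∘ σ = c := by
  choose s hs using h
  have hs' : Function.Injective s := fun i j hij => hc (by rw [← hs, ← hs, hij])
  exact ⟨Equiv.ofBijective s (Finite.injective_iff_bijective.1 hs'), funext hs⟩

variable {K : Type*} [Field K] {q : K} {A : Type*} [AddCommGroup A] [Module K A]

/-- The tuples that complete `b` to a tuple without repetition are the rearrangements of the
complementary tuple `e`. -/
theorem sum_qSign_append_right {b : Fin k → Fin N} (hb : b.Injective) {e : Fin m → Fin N}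
    (he : StrictMono e) (hbe : ∀ y, y ∈ Set.range e ↔ y ∉ Set.range b)
    (f : (Fin m → Fin N) → A) :
    ∑ c, qSign q (Fin.append b c) • f c
      = (-q) ^ (invCount b + crossCount b e) •
        ∑ σ : Equiv.Perm (Fin m), (-q) ^ permLength σ • f (e ∘ σ) := by
  classical
  rw [Finset.smul_sum]
  symm
  refine Finset.sum_of_injOn (fun σ : Equiv.Perm (Fin m) => e ∘ σ) ?_ (by simp) ?_ ?_
  · intro σ _ τ _ h
    ext1 i
    exact he.injective (congrFun h i)
  · intro c _ hc
    rw [qSign_of_not_injective, zero_smul]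
    intro hi
    obtain ⟨-, hci, hne⟩ := injective_of_append hi
    obtain ⟨σ, hσ⟩ := exists_perm_comp_eq (e := e) hci fun i =>
      (hbe _).2 fun ⟨j, hj⟩ => hne j i hj
    exact hc ⟨σ, by simp, hσ⟩
  · intro σ _
    rw [qSign_of_injective, invCount_append, invCount_comp_perm_of_strictMono he,
      crossCount_comp_perm_right, smul_smul, ← pow_add]
    · congr 2; omega
    · refine append_injective hb (he.injective.comp σ.injective) fun i j h => ?_
      exact (hbe _).1 ⟨σ j, rfl⟩ ⟨i, h⟩

theorem sum_qSign_append_left {b : Fin k → Fin N} (hb : b.Injective) {e : Fin m → Fin N}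
    (he : StrictMono e) (hbe : ∀ y, y ∈ Set.range e ↔ y ∉ Set.range b)
    (f : (Fin m → Fin N) → A) :
    ∑ c, qSign q (Fin.append c b) • f c
      = (-q) ^ (invCount b + crossCount e b) •
        ∑ σ : Equiv.Perm (Fin m), (-q) ^ permLength σ • f (e ∘ σ) := by
  classical
  rw [Finset.smul_sum]
  symm
  refine Finset.sum_of_injOn (fun σ : Equiv.Perm (Fin m) => e ∘ σ) ?_ (by simp) ?_ ?_
  · intro σ _ τ _ h
    ext1 i
    exact he.injective (congrFun h i)
  · intro c _ hc
    rw [qSign_of_not_injective, zero_smul]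
    intro hi
    obtain ⟨hci, -, hne⟩ := injective_of_append hi
    obtain ⟨σ, hσ⟩ := exists_perm_comp_eq (e := e) hci fun i =>
      (hbe _).2 fun ⟨j, hj⟩ => hne i j hj.symm
    exact hc ⟨σ, by simp, hσ⟩
  · intro σ _
    rw [qSign_of_injective, invCount_append, invCount_comp_perm_of_strictMono he,
      crossCount_comp_perm_left, smul_smul, ← pow_add]
    · congr 2; omega
    · refine append_injective (he.injective.comp σ.injective) hb fun i j h => ?_
      exact (hbe _).1 ⟨σ i, rfl⟩ ⟨j, h.symm⟩

end Append

section Laplace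

variable {K : Type*} [Field K] {q : K} {A : Type*} [Ring A] [Algebra K A] {N : ℕ}
  {x : Fin N → Fin N → A}

/-- `sum_qSign_prod` with the tuples cut into two pieces. -/
theorem sum_sum_qSign_append {k m : ℕ} (hkm : k + m = N) (hq : q ≠ 0)
    (hx : IsQuantumMatrix q x) (r : Fin k → Fin N) (r' : Fin m → Fin N) :
    ∑ c : Fin k → Fin N, ∑ c' : Fin m → Fin N, qSign q (Fin.append c c') •
      ((List.ofFn fun i => x (r i) (c i)).prod * (List.ofFn fun i => x (r' i) (c' i)).prod)
      = qSign q (Fin.append r r') • quantumDet q x := by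
  rw [← sum_qSign_prod hkm hq hx, ← (Fin.appendEquiv k m).sum_comp, Fintype.sum_prod_type]
  refine Finset.sum_congr rfl fun c _ => Finset.sum_congr rfl fun c' _ => ?_
  rw [← List.prod_append, ← List.ofFn_fin_append]
  have h : (fun i => x (Fin.append r r' i) (Fin.append c c' i))
      = Fin.append (fun i => x (r i) (c i)) fun i => x (r' i) (c' i) := by
    funext i
    refine Fin.addCases (fun i => ?_) (fun i => ?_) i <;> simp
  rw [← h]
  rfl


theorem mem_range_succAbove_iff {n : ℕ} (j y : Fin (n + 1)) :
    y ∈ Set.range j.succAbove ↔ y ∉ Set.range fun _ : Fin 1 => j := by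
  simp [eq_comm]

theorem crossCount_succAbove_right {n : ℕ} (j : Fin (n + 1)) :
    crossCount (fun _ : Fin 1 => j) j.succAbove = j := by
  have := crossCount_add_sum (b := fun _ : Fin 1 => j) (Subsingleton.strictMono _)
    (Fin.strictMono_succAbove j) (mem_range_succAbove_iff j)
  simpa using this

theorem crossCount_succAbove_left {n : ℕ} (j : Fin (n + 1)) :
    crossCount j.succAbove (fun _ : Fin 1 => j) = n - j := by
  have := crossCount_add_crossCount (b := fun _ : Fin 1 => j) (e := j.succAbove)
    fun _ i => (Fin.succAbove_ne j i).symm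
  rw [crossCount_succAbove_right] at this
  omega

theorem qSign_append_succAbove_right {n : ℕ} (i j : Fin (n + 1)) :
    qSign q (Fin.append (fun _ : Fin 1 => i) j.succAbove) = if i = j then (-q) ^ (j : ℕ) else 0 := by
  split_ifs with h
  · subst h
    rw [qSign_of_injective, invCount_append, crossCount_succAbove_right,
      invCount_of_strictMono (Subsingleton.strictMono _),
      invCount_of_strictMono (Fin.strictMono_succAbove i), zero_add, zero_add]
    exact append_injective (Function.injective_of_subsingleton _) Fin.succAbove_right_injective
      fun _ _ => (Fin.succAbove_ne _ _).symm
  · apply qSign_of_not_injective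
    intro hi
    obtain ⟨l, hl⟩ := Fin.exists_succAbove_eq h
    exact (injective_of_append hi).2.2 0 l hl.symm

theorem qSign_append_succAbove_left {n : ℕ} (i j : Fin (n + 1)) :
    qSign q (Fin.append j.succAbove (fun _ : Fin 1 => i))
      = if i = j then (-q) ^ (n - j : ℕ) else 0 := by
  split_ifs with h
  · subst h
    rw [qSign_of_injective, invCount_append, crossCount_succAbove_left,
      invCount_of_strictMono (Fin.strictMono_succAbove i),
      invCount_of_strictMono (Subsingleton.strictMono _), zero_add, zero_add]
    exact append_injective Fin.succAbove_right_injective (Function.injective_of_subsingleton _)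
      fun _ _ => (Fin.succAbove_ne _ _)
  · apply qSign_of_not_injective
    intro hi
    obtain ⟨l, hl⟩ := Fin.exists_succAbove_eq h
    exact (injective_of_append hi).2.2 l 0 hl

theorem quantumDet_eq_sum_prod {m : ℕ} (y : Fin m → Fin m → A) :
    ∑ σ : Equiv.Perm (Fin m), (-q) ^ permLength σ • (List.ofFn fun i => y i (σ i)).prod
      = quantumDet q y := rfl

/-- Laplace expansion along a row. -/
theorem sum_mul_minor {n : ℕ} {x : Fin (n + 1) → Fin (n + 1) → A} (hq : q ≠ 0)
    (hx : IsQuantumMatrix q x) (i j : Fin (n + 1)) :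
    ∑ l : Fin (n + 1), (-q) ^ (l : ℕ) •
      (x i l * quantumDet q fun a b => x (j.succAbove a) (l.succAbove b))
      = if i = j then (-q) ^ (j : ℕ) • quantumDet q x else 0 := by
  have h := sum_sum_qSign_append (add_comm 1 n) hq hx (fun _ => i) j.succAbove
  rw [qSign_append_succAbove_right, ite_smul, zero_smul] at h
  rw [← h, ← (Equiv.funUnique (Fin 1) (Fin (n + 1))).symm.sum_comp]
  refine Finset.sum_congr rfl fun l _ => ?_
  have h2 := sum_qSign_append_right (q := q) (b := fun _ : Fin 1 => l)
    (Function.injective_of_subsingleton _) (Fin.strictMono_succAbove l) (mem_range_succAbove_iff l)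
    fun c' => x i l * (List.ofFn fun a => x (j.succAbove a) (c' a)).prod
  rw [crossCount_succAbove_right, invCount_of_strictMono (Subsingleton.strictMono _),
    zero_add] at h2
  simp only [← mul_smul_comm, ← Finset.mul_sum] at h2
  simp only [Function.comp_apply, quantumDet_eq_sum_prod (q := q)
    (fun a b => x (j.succAbove a) (l.succAbove b))] at h2
  rw [← mul_smul_comm, ← h2, Finset.mul_sum]
  refine Finset.sum_congr rfl fun c' _ => ?_
  simp
  rfl

/-- Laplace expansion along a column. -/
theorem sum_minor_mul {n : ℕ} {x : Fin (n + 1) → Fin (n + 1) → A} (hq : q ≠ 0)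
    (hx : IsQuantumMatrix q x) (i j : Fin (n + 1)) :
    ∑ l : Fin (n + 1), (-q) ^ (n - l : ℕ) •
      ((quantumDet q fun a b => x (l.succAbove a) (j.succAbove b)) * x l i)
      = if i = j then (-q) ^ (n - j : ℕ) • quantumDet q x else 0 := by
  have h := sum_sum_qSign_append rfl hq hx.transpose j.succAbove (fun _ => i)
  rw [qSign_append_succAbove_left, ite_smul, zero_smul, quantumDet_transpose hx] at h
  rw [← h, Finset.sum_comm, ← (Equiv.funUnique (Fin 1) (Fin (n + 1))).symm.sum_comp]
  refine Finset.sum_congr rfl fun l _ => ?_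
  have h2 := sum_qSign_append_left (q := q) (b := fun _ : Fin 1 => l)
    (Function.injective_of_subsingleton _) (Fin.strictMono_succAbove l) (mem_range_succAbove_iff l)
    fun c' => (List.ofFn fun a => x (c' a) (j.succAbove a)).prod * x l i
  rw [crossCount_succAbove_left, invCount_of_strictMono (Subsingleton.strictMono _),
    zero_add] at h2
  simp only [← smul_mul_assoc, ← Finset.sum_mul] at h2
  simp only [Function.comp_apply, quantumDet_eq_sum_prod (q := q)
    (fun a b => x (l.succAbove b) (j.succAbove a))] at h2
  rw [quantumDet_transpose (x := fun a b => x (l.succAbove a) (j.succAbove b))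
    (hx.submatrix (fun _ _ h => Fin.strictMono_succAbove l h)
      fun _ _ h => Fin.strictMono_succAbove j h)] at h2
  rw [← smul_mul_assoc, ← h2, Finset.sum_mul]
  refine Finset.sum_congr rfl fun c' _ => ?_
  simp
  rfl

/-- The quantum adjugate of a quantum matrix: a two-sided inverse up to the quantum
determinant. -/
theorem exists_adjugate (hq : q ≠ 0) (hx : IsQuantumMatrix q x) :
    ∃ y : Fin N → Fin N → A,
      (∀ i j, ∑ l, x i l * y l j = if i = j then quantumDet q x else 0) ∧
      (∀ i j, ∑ l, y i l * x l j = if i = j then quantumDet q x else 0) := by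
  cases N with
  | zero => exact ⟨x, fun i => i.elim0, fun i => i.elim0⟩
  | succ n =>
    have hq' : -q ≠ 0 := neg_ne_zero.2 hq
    -- The same array serves for rows and for columns, since `(-q) ^ (n - i)` and `((-q) ^ i)⁻¹` differ
    -- by a factor that does not depend on `i`.
    refine ⟨fun i j => ((-q) ^ (i : ℕ) * ((-q) ^ (j : ℕ))⁻¹) •
      quantumDet q fun a b => x (j.succAbove a) (i.succAbove b), fun i j => ?_, fun i j => ?_⟩
    · have h := congrArg (((-q) ^ (j : ℕ))⁻¹ • ·) (sum_mul_minor hq hx i j)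
      simp only [Finset.smul_sum, smul_ite, smul_zero, smul_smul] at h
      rw [inv_mul_cancel₀ (pow_ne_zero _ hq'), one_smul] at h
      rw [← h]
      refine Finset.sum_congr rfl fun l _ => ?_
      rw [mul_smul_comm, mul_comm]
    · have h := congrArg (((-q) ^ (n - i : ℕ))⁻¹ • ·) (sum_minor_mul hq hx j i)
      simp only [Finset.smul_sum, smul_ite, smul_zero, smul_smul] at h
      rw [inv_mul_cancel₀ (pow_ne_zero _ hq'), one_smul] at h
      simp only [@eq_comm _ i j]
      rw [← h]
      refine Finset.sum_congr rfl fun l _ => ?_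
      rw [smul_mul_assoc]
      congr 1
      have h1 : (-q) ^ n = (-q) ^ (n - i : ℕ) * (-q) ^ (i : ℕ) := by
        rw [← pow_add]; congr 1; omega
      have h2 : (-q) ^ n = (-q) ^ (n - l : ℕ) * (-q) ^ (l : ℕ) := by
        rw [← pow_add]; congr 1; omega
      have := pow_ne_zero (n - i : ℕ) hq'
      have := pow_ne_zero (l : ℕ) hq'
      field_simp
      rw [mul_comm, ← h1, h2, mul_comm]

/-- An array `y` that is a two-sided inverse of `x` up to an element `D`: then `D` commutes with
the entries of both arrays. -/
theorem commute_of_adjugate {x y : Fin N → Fin N → A} {D : A}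
    (hxy : ∀ i j, ∑ l, x i l * y l j = if i = j then D else 0)
    (hyx : ∀ i j, ∑ l, y i l * x l j = if i = j then D else 0) (i j : Fin N) :
    Commute D (x i j) := by
  have h : ∑ l, (∑ p, x i p * y p l) * x l j = ∑ p, x i p * ∑ l, y p l * x l j := by
    simp only [Finset.sum_mul, Finset.mul_sum, mul_assoc]
    rw [Finset.sum_comm]
  simp only [hxy, hyx] at h
  simpa [Commute, SemiconjBy] using h

theorem commute_quantumDet (hq : q ≠ 0) (hx : IsQuantumMatrix q x) (i j : Fin N) :
    Commute (quantumDet q x) (x i j) := by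
  obtain ⟨y, hxy, hyx⟩ := exists_adjugate hq hx
  exact commute_of_adjugate hxy hyx i j

/-- The telescoping product of a word in the entries of `y`, in the reversed order, with a word in
the entries of `x`. -/
theorem sum_prod_reverse_mul_prod {y : Fin N → Fin N → A} {D : A}
    (hyx : ∀ i j, ∑ l, y i l * x l j = if i = j then D else 0)
    (hD : ∀ i j, Commute D (y i j)) {k : ℕ} (b c : Fin k → Fin N) :
    ∑ r : Fin k → Fin N,
      (List.ofFn fun i => y (b i) (r i)).reverse.prod * (List.ofFn fun i => x (r i) (c i)).prod
      = if b = c then D ^ k else 0 := by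
  induction k with
  | zero => simp [Subsingleton.elim b c]
  | succ k ih =>
    rw [← (Fin.consEquiv fun _ => Fin N).sum_comp, Fintype.sum_prod_type, Finset.sum_comm]
    have h : ∀ r : Fin k → Fin N, ∑ p : Fin N,
        (List.ofFn fun i => y (b i) ((Fin.consEquiv fun _ => Fin N) (p, r) i)).reverse.prod *
          (List.ofFn fun i => x ((Fin.consEquiv fun _ => Fin N) (p, r) i) (c i)).prod
        = (if b 0 = c 0 then D else 0) *
          ((List.ofFn fun i => y (b i.succ) (r i)).reverse.prod *
            (List.ofFn fun i => x (r i) (c i.succ)).prod) := by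
      intro r
      have hy : Commute D (List.ofFn fun i => y (b i.succ) (r i)).reverse.prod := by
        refine Commute.list_prod_right _ _ fun z hz => ?_
        rw [List.mem_reverse, List.mem_ofFn] at hz
        obtain ⟨i, rfl⟩ := hz
        exact hD _ _
      simp only [Fin.consEquiv, Equiv.coe_fn_mk, List.ofFn_succ, Fin.cons_zero, Fin.cons_succ,
        List.reverse_cons, List.prod_append, List.prod_cons, List.prod_nil, mul_one]
      simp only [mul_assoc]
      rw [← Finset.mul_sum]
      simp only [← mul_assoc (y _ _)]
      rw [← Finset.sum_mul, hyx]
      split_ifs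
      · rw [← mul_assoc, ← hy.eq, mul_assoc]
      · simp
    rw [Finset.sum_congr rfl fun r _ => h r, ← Finset.mul_sum, ih (fun i => b i.succ)]
    have hb : b = c ↔ b 0 = c 0 ∧ (fun i : Fin k => b i.succ) = fun i => c i.succ := by
      constructor
      · rintro rfl; simp
      · rintro ⟨h0, h1⟩
        funext i
        exact Fin.cases h0 (fun i => congrFun h1 i) i
    simp only [hb]
    by_cases h0 : b 0 = c 0 <;> simp [h0, pow_succ']

/-- The quantum Jacobi identity: minors of the adjugate are complementary minors of the matrix, up
to a power of the quantum determinant. -/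
theorem quantumDet_mul_adjugate_minor (hq : q ≠ 0) (hx : IsQuantumMatrix q x)
    {y : Fin N → Fin N → A}
    (hyx : ∀ i j, ∑ l, y i l * x l j = if i = j then quantumDet q x else 0)
    (hD : ∀ i j, Commute (quantumDet q x) (y i j)) {k m : ℕ} (hkm : k + m = N)
    {b : Fin k → Fin N} (hb : StrictMono b) {e : Fin m → Fin N} (he : StrictMono e)
    (hbe : ∀ z, z ∈ Set.range e ↔ z ∉ Set.range b)
    {s : Fin k → Fin N} (hs : StrictMono s) {r : Fin m → Fin N} (hr : StrictMono r)
    (hsr : ∀ z, z ∈ Set.range s ↔ z ∉ Set.range r) :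
    quantumDet q x * ((-q) ^ crossCount s r • ∑ σ : Equiv.Perm (Fin k), (-q) ^ permLength σ •
        (List.ofFn fun i => y (b i) (s (σ i))).reverse.prod)
      = quantumDet q x ^ k *
        ((-q) ^ crossCount b e • quantumDet q fun i j => x (r i) (e j)) := by
  set D := quantumDet q x with hDdef
  -- Multiply the row expansion of `D` on the left by the reversed words in `y` and sum.
  have hL : ∑ p : Fin k → Fin N, (List.ofFn fun i => y (b i) (p i)).reverse.prod *
      ∑ c : Fin k → Fin N, ∑ c' : Fin m → Fin N, qSign q (Fin.append c c') •
        ((List.ofFn fun i => x (p i) (c i)).prod * (List.ofFn fun i => x (r i) (c' i)).prod)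
      = D * ((-q) ^ crossCount s r • ∑ σ : Equiv.Perm (Fin k), (-q) ^ permLength σ •
        (List.ofFn fun i => y (b i) (s (σ i))).reverse.prod) := by
    have h := sum_qSign_append_left (q := q) hr.injective hs hsr
      fun p => (List.ofFn fun i => y (b i) (p i)).reverse.prod
    rw [invCount_of_strictMono hr, zero_add] at h
    simp only [Function.comp_apply] at h
    rw [← h, Finset.mul_sum]
    refine Finset.sum_congr rfl fun p _ => ?_
    rw [sum_sum_qSign_append hkm hq hx, mul_smul_comm, mul_smul_comm, ← hDdef]
    congr 1
    refine (Commute.list_prod_right _ _ fun z hz => ?_).eq.symm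
    rw [List.mem_reverse, List.mem_ofFn] at hz
    obtain ⟨i, rfl⟩ := hz
    exact hD _ _
  have hR : ∑ p : Fin k → Fin N, (List.ofFn fun i => y (b i) (p i)).reverse.prod *
      ∑ c : Fin k → Fin N, ∑ c' : Fin m → Fin N, qSign q (Fin.append c c') •
        ((List.ofFn fun i => x (p i) (c i)).prod * (List.ofFn fun i => x (r i) (c' i)).prod)
      = D ^ k * ((-q) ^ crossCount b e • quantumDet q fun i j => x (r i) (e j)) := by
    have h := sum_qSign_append_right (q := q) hb.injective he hbe
      fun c' => (List.ofFn fun i => x (r i) (c' i)).prod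
    rw [invCount_of_strictMono hb, zero_add] at h
    simp only [Function.comp_apply, quantumDet_eq_sum_prod (q := q) fun i j => x (r i) (e j)] at h
    rw [← h]
    simp only [Finset.mul_sum]
    rw [Finset.sum_comm]
    have h2 : ∀ c : Fin k → Fin N, ∑ p : Fin k → Fin N, ∑ c' : Fin m → Fin N,
        (List.ofFn fun i => y (b i) (p i)).reverse.prod * qSign q (Fin.append c c') •
        ((List.ofFn fun i => x (p i) (c i)).prod * (List.ofFn fun i => x (r i) (c' i)).prod)
        = ∑ c' : Fin m → Fin N, (if b = c then D ^ k else 0) *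
          qSign q (Fin.append c c') • (List.ofFn fun i => x (r i) (c' i)).prod := by
      intro c
      rw [Finset.sum_comm]
      refine Finset.sum_congr rfl fun c' _ => ?_
      rw [← sum_prod_reverse_mul_prod hyx hD b c, Finset.sum_mul]
      refine Finset.sum_congr rfl fun p _ => ?_
      simp only [mul_smul_comm, mul_assoc]
    rw [Finset.sum_congr rfl fun c _ => h2 c, Finset.sum_comm]
    refine Finset.sum_congr rfl fun c' _ => ?_
    simp [ite_mul]
  rw [← hL, hR]

end Laplace

/-! ### Partial quantum matrices and skew derivations -/

section Partial

variable {K : Type*} [Field K] (q : K) {m n : ℕ}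

/-- The array `x` of elements of a `K`-algebra vanishes outside the set `S` of positions and
satisfies the relations of quantum matrices that involve positions in `S`. -/
structure IsPartialQuantumMatrix {A : Type*} [Ring A] [Algebra K A] (S : Set (Fin m × Fin n))
    (x : Fin m → Fin n → A) : Prop where
  row : ∀ i j l, (i, j) ∈ S → (i, l) ∈ S → j < l → x i j * x i l = q • (x i l * x i j)
  col : ∀ i s j, (i, j) ∈ S → (s, j) ∈ S → i < s → x i j * x s j = q • (x s j * x i j)
  anti : ∀ i s j l, (i, j) ∈ S → (s, l) ∈ S → s < i → j < l → x i j * x s l = x s l * x i j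
  diag : ∀ i s j l, (i, j) ∈ S → (s, l) ∈ S → i < s → j < l →
    x i j * x s l - x s l * x i j = (q - q⁻¹) • (x i l * x s j)
  zero : ∀ i j, (i, j) ∉ S → x i j = 0

/-- The relations that define the algebra generated by the entries of a quantum matrix in the
positions of `S`. -/
inductive PartialRel (S : Set (Fin m × Fin n)) :
    FreeAlgebra K (Fin m × Fin n) → FreeAlgebra K (Fin m × Fin n) → Prop
  | row (i : Fin m) (j l : Fin n) (h₁ : (i, j) ∈ S) (h₂ : (i, l) ∈ S) (h : j < l) :
      PartialRel S
        (FreeAlgebra.ι K (i, j) * FreeAlgebra.ι K (i, l))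
        (q • (FreeAlgebra.ι K (i, l) * FreeAlgebra.ι K (i, j)))
  | col (i s : Fin m) (j : Fin n) (h₁ : (i, j) ∈ S) (h₂ : (s, j) ∈ S) (h : i < s) :
      PartialRel S
        (FreeAlgebra.ι K (i, j) * FreeAlgebra.ι K (s, j))
        (q • (FreeAlgebra.ι K (s, j) * FreeAlgebra.ι K (i, j)))
  | anti (i s : Fin m) (j l : Fin n) (h₁ : (i, j) ∈ S) (h₂ : (s, l) ∈ S) (h : s < i)
      (h' : j < l) :
      PartialRel S
        (FreeAlgebra.ι K (i, j) * FreeAlgebra.ι K (s, l))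
        (FreeAlgebra.ι K (s, l) * FreeAlgebra.ι K (i, j))
  | diag (i s : Fin m) (j l : Fin n) (h₁ : (i, j) ∈ S) (h₂ : (s, l) ∈ S) (h : i < s)
      (h' : j < l) :
      PartialRel S
        (FreeAlgebra.ι K (i, j) * FreeAlgebra.ι K (s, l)
          - FreeAlgebra.ι K (s, l) * FreeAlgebra.ι K (i, j))
        ((q - q⁻¹) • (FreeAlgebra.ι K (i, l) * FreeAlgebra.ι K (s, j)))
  | zero (i : Fin m) (j : Fin n) (h : (i, j) ∉ S) : PartialRel S (FreeAlgebra.ι K (i, j)) 0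

/-- The algebra generated by the entries of a quantum matrix in the positions of `S`. -/
abbrev PartialQMatrix (S : Set (Fin m × Fin n)) : Type _ := RingQuot (PartialRel q S)

namespace PartialQMatrix

/-- The generator in the position `(i, j)`; it is zero for `(i, j) ∉ S`. -/
noncomputable def gen (S : Set (Fin m × Fin n)) (i : Fin m) (j : Fin n) : PartialQMatrix q S :=
  RingQuot.mkAlgHom K (PartialRel q S) (FreeAlgebra.ι K (i, j))

theorem isPartialQuantumMatrix_gen (S : Set (Fin m × Fin n)) :
    IsPartialQuantumMatrix q S (gen q S) where
  row i j l h₁ h₂ h := by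
    simpa [gen] using RingQuot.mkAlgHom_rel K (PartialRel.row (q := q) i j l h₁ h₂ h)
  col i s j h₁ h₂ h := by
    simpa [gen] using RingQuot.mkAlgHom_rel K (PartialRel.col (q := q) i s j h₁ h₂ h)
  anti i s j l h₁ h₂ h h' := by
    simpa [gen] using RingQuot.mkAlgHom_rel K (PartialRel.anti (q := q) i s j l h₁ h₂ h h')
  diag i s j l h₁ h₂ h h' := by
    have := RingQuot.mkAlgHom_rel K (PartialRel.diag (q := q) i s j l h₁ h₂ h h')
    rw [map_sub, map_smul, map_mul, map_mul, map_mul] at this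
    exact this
  zero i j h := by
    simpa [gen] using RingQuot.mkAlgHom_rel K (PartialRel.zero (q := q) i j h)

variable {q}

variable {A : Type*} [Ring A] [Algebra K A] {S : Set (Fin m × Fin n)}

/-- The algebra map out of `PartialQMatrix q S` given by an array that satisfies its relations. -/
noncomputable def lift {x : Fin m → Fin n → A} (hx : IsPartialQuantumMatrix q S x) :
    PartialQMatrix q S →ₐ[K] A :=
  RingQuot.liftAlgHom K ⟨FreeAlgebra.lift K fun p => x p.1 p.2, by
    rintro _ _ (⟨i, j, l, h₁, h₂, h⟩ | ⟨i, s, j, h₁, h₂, h⟩ | ⟨i, s, j, l, h₁, h₂, h, h'⟩ |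
      ⟨i, s, j, l, h₁, h₂, h, h'⟩ | ⟨i, j, h⟩)
    · simpa using hx.row i j l h₁ h₂ h
    · simpa using hx.col i s j h₁ h₂ h
    · simpa using hx.anti i s j l h₁ h₂ h h'
    · rw [map_sub, map_smul, map_mul, map_mul, map_mul]
      simpa only [FreeAlgebra.lift_ι_apply] using hx.diag i s j l h₁ h₂ h h'
    · simpa using hx.zero i j h⟩

@[simp]
theorem lift_gen {x : Fin m → Fin n → A} (hx : IsPartialQuantumMatrix q S x) (i : Fin m)
    (j : Fin n) : lift hx (gen q S i j) = x i j := by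
  simp [lift, gen]

theorem induction {P : PartialQMatrix q S → Prop} (halg : ∀ c : K, P (algebraMap K _ c))
    (hgen : ∀ i j, P (gen q S i j)) (hadd : ∀ a b, P a → P b → P (a + b))
    (hmul : ∀ a b, P a → P b → P (a * b)) (a : PartialQMatrix q S) : P a := by
  obtain ⟨a, rfl⟩ := RingQuot.mkAlgHom_surjective K (PartialRel q S) a
  induction a using FreeAlgebra.induction with
  | grade0 c => simpa using halg c
  | grade1 p => exact hgen p.1 p.2
  | mul a b ha hb => rw [map_mul]; exact hmul _ _ ha hb
  | add a b ha hb => rw [map_add]; exact hadd _ _ ha hb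

end PartialQMatrix

end Partial

section Derivation

variable {K : Type*} [Field K] {q : K} {m n : ℕ} {A : Type*} [Ring A] [Algebra K A]

/-- The positions that precede `(a, b)` in the order of reading. -/
def before (a : Fin m) (b : Fin n) : Set (Fin m × Fin n) :=
  {p | p.1 < a ∨ p.1 = a ∧ p.2 < b}

/-- The factor by which `x i j` is scaled when it is moved past `x a b`. -/
def oreScale (q : K) (a : Fin m) (b : Fin n) (i : Fin m) (j : Fin n) : K :=
  (if i = a then q⁻¹ else 1) * if j = b then q⁻¹ else 1

/-- The correction that appears when `x a b` is moved past `x i j`. -/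
noncomputable def oreCorrection (q : K) (x : Fin m → Fin n → A) (a : Fin m) (b : Fin n)
    (i : Fin m) (j : Fin n) : A :=
  open Classical in if i < a ∧ j < b then -(q - q⁻¹) • (x i b * x a j) else 0

theorem oreScale_mul_oreScale (a : Fin m) (b : Fin n) (i s : Fin m) (j l : Fin n) :
    oreScale q a b i j * oreScale q a b s l = oreScale q a b i l * oreScale q a b s j := by
  unfold oreScale; ring

theorem oreScale_ne_zero (hq : q ≠ 0) (a : Fin m) (b : Fin n) (i : Fin m) (j : Fin n) :
    oreScale q a b i j ≠ 0 := by
  unfold oreScale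
  split_ifs <;> simp [hq]

theorem IsPartialQuantumMatrix.scale {S : Set (Fin m × Fin n)} {x : Fin m → Fin n → A}
    (hx : IsPartialQuantumMatrix q S x) {c : Fin m → Fin n → K}
    (hc : ∀ i s j l, c i j * c s l = c i l * c s j) :
    IsPartialQuantumMatrix q S fun i j => c i j • x i j where
  row i j l h₁ h₂ h := by
    simp only [smul_mul_smul_comm, hx.row _ _ _ h₁ h₂ h]
    module
  col i s j h₁ h₂ h := by
    simp only [smul_mul_smul_comm, hx.col _ _ _ h₁ h₂ h]
    module
  anti i s j l h₁ h₂ h h' := by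
    simp only [smul_mul_smul_comm, hx.anti _ _ _ _ h₁ h₂ h h']
    module
  diag i s j l h₁ h₂ h h' := by
    have := hx.diag _ _ _ _ h₁ h₂ h h'
    rw [sub_eq_iff_eq_add] at this
    simp only [smul_mul_smul_comm, this, ← hc i s j l]
    module
  zero i j h := by rw [hx.zero i j h, smul_zero]

variable {a : Fin m} {b : Fin n} {x : Fin m → Fin n → A}

theorem mul_mul_of_mul_eq {R : Type*} [Semigroup R] {y z w : R} (h : y * z = w) (t : R) :
    y * (z * t) = w * t := by rw [← mul_assoc, h]

theorem mem_before_of_lt {i : Fin m} (h : i < a) (j : Fin n) : (i, j) ∈ before a b := Or.inl h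

theorem mem_before_of_lt_right {j : Fin n} (h : j < b) : (a, j) ∈ before a b := Or.inr ⟨rfl, h⟩

theorem oreCorrection_of_lt {i : Fin m} {j : Fin n} (h : i < a) (h' : j < b) :
    oreCorrection q x a b i j = -(q - q⁻¹) • (x i b * x a j) := if_pos ⟨h, h'⟩

theorem oreCorrection_of_row (j : Fin n) : oreCorrection q x a b a j = 0 :=
  if_neg fun h => lt_irrefl _ h.1

theorem oreCorrection_of_le {i : Fin m} {j : Fin n} (h : b ≤ j) :
    oreCorrection q x a b i j = 0 := if_neg fun h' => not_lt.2 h h'.2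

theorem oreScale_of_ne {i : Fin m} {j : Fin n} (h : i ≠ a) (h' : j ≠ b) :
    oreScale q a b i j = 1 := by simp [oreScale, h, h']

theorem oreScale_row {j : Fin n} (h : j ≠ b) :
    oreScale q a b a j = q⁻¹ := by simp [oreScale, h]

theorem oreScale_col {i : Fin m} (h : i ≠ a) :
    oreScale q a b i b = q⁻¹ := by simp [oreScale, h]

/-- The twisted Leibniz rule respects the relations of a row. Together with the three lemmas that
follow, this makes the skew derivation well defined. -/
theorem oreCorrection_row (hq : q ≠ 0) (hx : IsPartialQuantumMatrix q (before a b) x)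
    (i : Fin m) (j l : Fin n) (h₁ : (i, j) ∈ before a b) (h : j < l) :
    oreScale q a b i j • x i j * oreCorrection q x a b i l + oreCorrection q x a b i j * x i l
      = q • (oreScale q a b i l • x i l * oreCorrection q x a b i j
        + oreCorrection q x a b i l * x i j) := by
  rcases h₁ with hi | ⟨hi, -⟩
  swap
  · simp only at hi; subst hi; simp [oreCorrection_of_row]
  simp only at hi
  have I := fun j : Fin n => mem_before_of_lt (b := b) hi j
  rcases lt_trichotomy l b with hl | rfl | hl
  · have hj : j < b := h.trans hl
    have e1 := hx.anti a i j l (mem_before_of_lt_right hj) (I l) hi h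
    have e2 := hx.diag i a j l (I j) (mem_before_of_lt_right hl) hi h
    rw [sub_eq_iff_eq_add, ← sub_eq_iff_eq_add'] at e2
    have e3 := hx.row i j b (I j) (I b) hj
    have e4 := hx.row i l b (I l) (I b) hl
    rw [oreCorrection_of_lt hi hl, oreCorrection_of_lt hi hj, oreScale_of_ne hi.ne hj.ne,
      oreScale_of_ne hi.ne hl.ne]
    simp only [one_smul, mul_assoc, smul_mul_assoc, mul_smul_comm, mul_mul_of_mul_eq e3,
      mul_mul_of_mul_eq e4, ← e2, e1, mul_sub, smul_sub, smul_add, smul_smul]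
    match_scalars <;> field_simp
    ring
  · have e1 := hx.anti a i j l (mem_before_of_lt_right h) (I l) hi h
    rw [oreCorrection_of_lt hi h, oreCorrection_of_le le_rfl, oreScale_col hi.ne]
    simp only [mul_assoc, smul_mul_assoc, mul_smul_comm, e1, smul_smul, mul_zero, zero_mul,
      zero_add, add_zero]
    match_scalars; field_simp
  · rw [oreCorrection_of_le hl.le]
    rcases lt_or_ge j b with hj | hj
    · have e1 := hx.anti a i j l (mem_before_of_lt_right hj) (I l) hi h
      have e2 := hx.row i b l (I b) (I l) hl
      rw [oreCorrection_of_lt hi hj, oreScale_of_ne hi.ne hl.ne']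
      simp only [mul_assoc, smul_mul_assoc, mul_smul_comm, e1, smul_smul, mul_zero, zero_mul,
        mul_mul_of_mul_eq e2, zero_add, add_zero]
      match_scalars; field_simp
    · simp [oreCorrection_of_le hj]

theorem oreCorrection_col (hq : q ≠ 0) (hx : IsPartialQuantumMatrix q (before a b) x)
    (i s : Fin m) (j : Fin n) (h₂ : (s, j) ∈ before a b) (h : i < s) :
    oreScale q a b i j • x i j * oreCorrection q x a b s j + oreCorrection q x a b i j * x s j
      = q • (oreScale q a b s j • x s j * oreCorrection q x a b i j
        + oreCorrection q x a b s j * x i j) := by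
  rcases lt_or_ge j b with hj | hj
  swap
  · simp [oreCorrection_of_le hj]
  have J : (a, j) ∈ before a b := mem_before_of_lt_right hj
  rcases h₂ with hs | ⟨hs, -⟩
  · simp only at hs
    have hi := h.trans hs
    have I := fun j : Fin n => mem_before_of_lt (b := b) hi j
    have S := fun j : Fin n => mem_before_of_lt (b := b) hs j
    have e1 := hx.diag i s j b (I j) (S b) h hj
    rw [sub_eq_iff_eq_add] at e1
    have e2 := hx.col s a j (S j) J hs
    have e3 := hx.anti s i j b (S j) (I b) h hj
    have e4 := hx.col i a j (I j) J hi
    rw [oreCorrection_of_lt hs hj, oreCorrection_of_lt hi hj, oreScale_of_ne hi.ne hj.ne,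
      oreScale_of_ne hs.ne hj.ne]
    simp only [one_smul, mul_assoc, smul_mul_assoc, mul_smul_comm, mul_mul_of_mul_eq e1,
      mul_mul_of_mul_eq e3, e2, e4, add_mul, smul_add, smul_smul]
    match_scalars <;> field_simp
    ring
  · simp only at hs
    subst hs
    have e1 := hx.anti s i j b J (mem_before_of_lt h b) h hj
    rw [oreCorrection_of_lt h hj, oreCorrection_of_row, oreScale_row hj.ne]
    simp only [mul_assoc, smul_mul_assoc, mul_smul_comm, mul_mul_of_mul_eq e1, smul_smul, mul_zero,
      zero_mul, zero_add, add_zero]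
    match_scalars; field_simp

theorem oreCorrection_anti (hq : q ≠ 0) (hx : IsPartialQuantumMatrix q (before a b) x)
    (i s : Fin m) (j l : Fin n) (h₁ : (i, j) ∈ before a b) (h : s < i) (h' : j < l) :
    oreScale q a b i j • x i j * oreCorrection q x a b s l + oreCorrection q x a b i j * x s l
      = oreScale q a b s l • x s l * oreCorrection q x a b i j
        + oreCorrection q x a b s l * x i j := by
  rcases h₁ with hi | ⟨hi, hj⟩
  · simp only at hi
    have hs := h.trans hi
    have I := fun j : Fin n => mem_before_of_lt (b := b) hi j
    have S := fun j : Fin n => mem_before_of_lt (b := b) hs j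
    rcases lt_or_ge j b with hj | hj
    swap
    · simp [oreCorrection_of_le hj, oreCorrection_of_le (hj.trans h'.le)]
    have J : (a, j) ∈ before a b := mem_before_of_lt_right hj
    have e1 := hx.anti a s j l J (S l) hs h'
    rcases lt_trichotomy l b with hl | rfl | hl
    · have e2 := hx.anti i s j b (I j) (S b) h hj
      have e3 := hx.diag s i l b (S l) (I b) h hl
      rw [sub_eq_iff_eq_add] at e3
      have e4 := hx.diag i a j l (I j) (mem_before_of_lt_right hl) hi h'
      rw [sub_eq_iff_eq_add, ← sub_eq_iff_eq_add'] at e4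
      rw [oreCorrection_of_lt hi hj, oreCorrection_of_lt hs hl, oreScale_of_ne hi.ne hj.ne,
        oreScale_of_ne hs.ne hl.ne]
      simp only [one_smul, mul_assoc, smul_mul_assoc, mul_smul_comm, mul_mul_of_mul_eq e2,
        mul_mul_of_mul_eq e3, e1, ← e4, add_mul, mul_sub, smul_sub, smul_add, smul_smul]
      module
    · have e2 := hx.col s i l (S l) (I l) h
      rw [oreCorrection_of_lt hi hj, oreCorrection_of_le le_rfl, oreScale_col hs.ne]
      simp only [mul_assoc, smul_mul_assoc, mul_smul_comm, e1, smul_smul, mul_zero, zero_mul,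
        mul_mul_of_mul_eq e2, zero_add, add_zero]
      match_scalars; field_simp
    · have e2 := hx.anti i s b l (I b) (S l) h hl
      rw [oreCorrection_of_lt hi hj, oreCorrection_of_le hl.le, oreScale_of_ne hs.ne hl.ne']
      simp only [mul_assoc, smul_mul_assoc, mul_smul_comm, e1, mul_zero, zero_mul,
        mul_mul_of_mul_eq e2, zero_add, add_zero, one_smul]
  · simp only at hi hj
    subst hi
    rcases lt_or_ge l b with hl | hl
    swap
    · simp [oreCorrection_of_le hl, oreCorrection_of_row]
    have J : (i, j) ∈ before i b := mem_before_of_lt_right hj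
    have e1 := hx.anti i s j b J (mem_before_of_lt h b) h hj
    have e2 := hx.row i j l J (mem_before_of_lt_right hl) h'
    rw [oreCorrection_of_lt h hl, oreCorrection_of_row, oreScale_row hj.ne]
    simp only [mul_assoc, smul_mul_assoc, mul_smul_comm, mul_mul_of_mul_eq e1, e2, smul_smul,
      mul_zero, zero_mul, zero_add, add_zero]
    match_scalars; field_simp

theorem oreCorrection_diag (hq : q ≠ 0) (hx : IsPartialQuantumMatrix q (before a b) x)
    (i s : Fin m) (j l : Fin n) (h₂ : (s, l) ∈ before a b) (h : i < s) (h' : j < l) :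
    (oreScale q a b i j • x i j * oreCorrection q x a b s l + oreCorrection q x a b i j * x s l)
      - (oreScale q a b s l • x s l * oreCorrection q x a b i j
        + oreCorrection q x a b s l * x i j)
      = (q - q⁻¹) • (oreScale q a b i l • x i l * oreCorrection q x a b s j
        + oreCorrection q x a b i l * x s j) := by
  rcases h₂ with hs | ⟨hs, hl⟩
  · simp only at hs
    have hi := h.trans hs
    have I := fun j : Fin n => mem_before_of_lt (b := b) hi j
    have S := fun j : Fin n => mem_before_of_lt (b := b) hs j
    rcases lt_or_ge j b with hj | hj
    swap
    · simp [oreCorrection_of_le hj, oreCorrection_of_le (hj.trans h'.le)]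
    have J : (a, j) ∈ before a b := mem_before_of_lt_right hj
    have e1 := hx.anti a s j l J (S l) hs h'
    rcases lt_trichotomy l b with hl | rfl | hl
    · have L : (a, l) ∈ before a b := mem_before_of_lt_right hl
      have e2 := hx.diag i s j b (I j) (S b) h hj
      rw [sub_eq_iff_eq_add] at e2
      have e3 := hx.anti s i l b (S l) (I b) h hl
      have e4 := hx.diag i a j l (I j) L hi h'
      rw [sub_eq_iff_eq_add, ← sub_eq_iff_eq_add'] at e4
      have e5 := hx.diag i s l b (I l) (S b) h hl
      rw [sub_eq_iff_eq_add] at e5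
      have e6 := hx.diag s a j l (S j) L hs h'
      rw [sub_eq_iff_eq_add, ← sub_eq_iff_eq_add'] at e6
      rw [oreCorrection_of_lt hi hj, oreCorrection_of_lt hs hl, oreCorrection_of_lt hi hl,
        oreCorrection_of_lt hs hj, oreScale_of_ne hi.ne hj.ne,
        oreScale_of_ne hs.ne hl.ne, oreScale_of_ne hi.ne hl.ne]
      simp only [one_smul, mul_assoc, smul_mul_assoc, mul_smul_comm, mul_mul_of_mul_eq e2,
        mul_mul_of_mul_eq e3, mul_mul_of_mul_eq e5, e1, ← e4, ← e6, add_mul, mul_sub, smul_sub,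
        smul_add, smul_smul]
      module
    · have e2 := hx.col i s l (I l) (S l) h
      rw [oreCorrection_of_lt hi hj, oreCorrection_of_le le_rfl, oreCorrection_of_le le_rfl,
        oreCorrection_of_lt hs hj, oreScale_col hs.ne, oreScale_col hi.ne]
      simp only [mul_assoc, smul_mul_assoc, mul_smul_comm, e1, smul_smul, mul_zero, zero_mul,
        mul_mul_of_mul_eq e2, zero_add, add_zero]
      match_scalars; field_simp; ring
    · have e2 := hx.diag i s b l (I b) (S l) h hl
      rw [sub_eq_iff_eq_add] at e2
      rw [oreCorrection_of_lt hi hj, oreCorrection_of_le hl.le, oreCorrection_of_le hl.le,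
        oreCorrection_of_lt hs hj, oreScale_of_ne hs.ne hl.ne', oreScale_of_ne hi.ne hl.ne']
      simp only [mul_assoc, smul_mul_assoc, mul_smul_comm, e1, mul_zero, zero_mul, add_mul,
        smul_add, mul_mul_of_mul_eq e2, zero_add, add_zero, one_smul, smul_smul]
      module
  · simp only at hs hl
    subst hs
    have hj := h'.trans hl
    have L : (s, l) ∈ before s b := mem_before_of_lt_right hl
    have e1 := hx.anti s i l b L (mem_before_of_lt h b) h hl
    have e2 := hx.row s j l (mem_before_of_lt_right hj) L h'
    rw [oreCorrection_of_lt h hl, oreCorrection_of_lt h hj, oreCorrection_of_row,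
      oreCorrection_of_row, oreScale_row hl.ne]
    simp only [mul_assoc, smul_mul_assoc, mul_smul_comm, mul_mul_of_mul_eq e1, e2, smul_smul,
      mul_zero, zero_mul, zero_add, add_zero]
    match_scalars; field_simp; ring

theorem triangular_mul (y z w y' z' w' : A) :
    !![y, z; 0, w] * !![y', z'; 0, w'] = !![y * y', y * z' + z * w'; 0, w * w'] := by
  ext i j
  fin_cases i <;> fin_cases j <;> simp [Matrix.mul_apply, Fin.sum_univ_two]

/-- The relations in triangular matrices with the diagonal `(σ, 1)`: the upper right entry expresses
the twisted Leibniz rule `δ(rs) = σ(r) δ(s) + δ(r) s`. -/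
theorem IsPartialQuantumMatrix.triangular (hq : q ≠ 0)
    (hx : IsPartialQuantumMatrix q (before a b) x) :
    IsPartialQuantumMatrix q (before a b) fun i j =>
      (!![oreScale q a b i j • x i j, oreCorrection q x a b i j; 0, x i j] :
        Matrix (Fin 2) (Fin 2) A) := by
  have hs := hx.scale (c := oreScale q a b) fun i s j l => oreScale_mul_oreScale a b i s j l
  constructor
  · intro i j l h₁ h₂ h
    rw [triangular_mul, triangular_mul, oreCorrection_row hq hx i j l h₁ h, hs.row i j l h₁ h₂ h,
      hx.row i j l h₁ h₂ h]
    simp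
  · intro i s j h₁ h₂ h
    rw [triangular_mul, triangular_mul, oreCorrection_col hq hx i s j h₂ h, hs.col i s j h₁ h₂ h,
      hx.col i s j h₁ h₂ h]
    simp
  · intro i s j l h₁ h₂ h h'
    rw [triangular_mul, triangular_mul, oreCorrection_anti hq hx i s j l h₁ h h',
      hs.anti i s j l h₁ h₂ h h', hx.anti i s j l h₁ h₂ h h']
  · intro i s j l h₁ h₂ h h'
    have e1 := oreCorrection_diag hq hx i s j l h₂ h h'
    have e2 := hs.diag i s j l h₁ h₂ h h'
    have e3 := hx.diag i s j l h₁ h₂ h h'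
    rw [triangular_mul, triangular_mul, triangular_mul]
    ext p r
    fin_cases p <;> fin_cases r
    · simpa using e2
    · simpa using e1
    · simp
    · simpa using e3
  · intro i j h
    have h' : oreCorrection q x a b i j = 0 :=
      if_neg fun h' => h (Or.inl h'.1)
    rw [hx.zero i j h, h', smul_zero]
    ext p r
    fin_cases p <;> fin_cases r <;> rfl

end Derivation

/-! ### Ore extensions without zero divisors -/

section Ore

variable {K R : Type*} [Field K] [Ring R] [Algebra K R]

/-- Left multiplication by the indeterminate `x` of the Ore extension `R[x; σ, δ]`, in which
`x r = σ(r) x + δ(r)`, on sequences of coefficients; the coefficients stand on the left of the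
powers of `x`. -/
def oreOp (σ : R →ₐ[K] R) (δ : R →ₗ[K] R) : Module.End K (ℕ → R) where
  toFun p i := Nat.casesOn (motive := fun _ => R) i 0 (fun i => σ (p i)) + δ (p i)
  map_add' p p' := by
    funext i
    cases i <;> simp
    abel
  map_smul' c p := by
    funext i
    cases i <;> simp

variable {σ : R →ₐ[K] R} {δ : R →ₗ[K] R}

theorem oreOp_zero (p : ℕ → R) : oreOp σ δ p 0 = δ (p 0) := by simp [oreOp]

theorem oreOp_succ (p : ℕ → R) (i : ℕ) : oreOp σ δ p (i + 1) = σ (p i) + δ (p (i + 1)) := rfl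

theorem oreOp_mul_lsmul (hδ : ∀ r s, δ (r * s) = σ r * δ s + δ r * s) (r : R) :
    oreOp σ δ * Algebra.lsmul K K (ℕ → R) r
      = Algebra.lsmul K K (ℕ → R) (σ r) * oreOp σ δ + Algebra.lsmul K K (ℕ → R) (δ r) := by
  refine LinearMap.ext fun p => funext fun i => ?_
  cases i with
  | zero => simp [oreOp_zero, hδ]
  | succ i =>
    simp [oreOp_succ, hδ, mul_add]
    abel

/-- A power of the operator raises the degree by its exponent and twists the leading coefficient. -/
theorem oreOp_pow_top {p : ℕ → R} {e : ℕ} (hp : ∀ i, e < i → p i = 0) (d : ℕ) :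
    ((oreOp σ δ ^ d) p (e + d) = σ^[d] (p e)) ∧ ∀ i, e + d < i → (oreOp σ δ ^ d) p i = 0 := by
  induction d with
  | zero => exact ⟨rfl, hp⟩
  | succ d ih =>
    rw [pow_succ', Function.iterate_succ_apply', ← ih.1]
    refine ⟨?_, fun i hi => ?_⟩
    · rw [Module.End.mul_apply, ← add_assoc, oreOp_succ, ih.2 _ (Nat.lt_succ_self _), map_zero,
        add_zero]
    · cases i with
      | zero => omega
      | succ i =>
        rw [Module.End.mul_apply, oreOp_succ, ih.2 _ (by omega), ih.2 _ (by omega), map_zero,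
          map_zero, add_zero]

theorem oreOp_pow_single (hδ1 : δ 1 = 0) (i : ℕ) :
    (oreOp σ δ ^ i) (Pi.single 0 1) = (Pi.single i 1 : ℕ → R) := by
  induction i with
  | zero => simp
  | succ i ih =>
    rw [pow_succ', Module.End.mul_apply, ih]
    funext j
    cases j with
    | zero =>
      rw [oreOp_zero]
      by_cases hi : i = 0
      · subst hi; simp [hδ1]
      · simp [Ne.symm hi]
    | succ j =>
      rw [oreOp_succ]
      by_cases h1 : j = i <;> by_cases h2 : j + 1 = i <;> simp [h1, h2, hδ1]

variable {B : Type*} [Ring B] [Algebra K B]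

/-- An algebra `B` that is generated by the image of `R` and an element `x` with
`x r = σ(r) x + δ(r)`, and which acts on sequences like the Ore extension `R[x; σ, δ]`, has no zero
divisors if `R` has none and `σ` is injective. -/
theorem noZeroDivisors_of_ore [NoZeroDivisors R] (hσ : Function.Injective σ)
    (hδ : ∀ r s, δ (r * s) = σ r * δ s + δ r * s) (f : R →ₐ[K] B) (x : B)
    (hx : ∀ r, x * f r = f (σ r) * x + f (δ r))
    (hgen : Algebra.adjoin K (Set.range f ∪ {x}) = ⊤)
    (G : B →ₐ[K] Module.End K (ℕ → R)) (hGf : ∀ r, G (f r) = Algebra.lsmul K K (ℕ → R) r)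
    (hGx : G x = oreOp σ δ) : NoZeroDivisors B := by
  have hδ1 : δ 1 = 0 := by simpa using hδ 1 1
  -- The normal form `∑ rᵢ xⁱ` of an element.
  let nf : (ℕ →₀ R) →+ B := Finsupp.liftAddHom fun i =>
    (AddMonoidHom.mulRight (x ^ i)).comp (f : R →+* B).toAddMonoidHom
  have hnf : ∀ i r, nf (Finsupp.single i r) = f r * x ^ i := fun i r => by
    simp [nf]
  have hsurj : ∀ u : B, ∃ p, nf p = u := by
    have hmul : ∀ u : B, ∀ p, ∃ p', nf p' = u * nf p := by
      intro u
      have hu : u ∈ Algebra.adjoin K (Set.range f ∪ {x}) := hgen ▸ Algebra.mem_top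
      induction hu using Algebra.adjoin_induction with
      | mem u hu =>
        intro p
        induction p using Finsupp.induction_linear with
        | zero => exact ⟨0, by simp⟩
        | add p p' hp hp' =>
          obtain ⟨s, hs⟩ := hp
          obtain ⟨s', hs'⟩ := hp'
          exact ⟨s + s', by rw [map_add, map_add, hs, hs', mul_add]⟩
        | single i r =>
          rcases hu with ⟨r', rfl⟩ | rfl
          · exact ⟨Finsupp.single i (r' * r), by rw [hnf, hnf, map_mul, mul_assoc]⟩
          · refine ⟨Finsupp.single (i + 1) (σ r) + Finsupp.single i (δ r), ?_⟩
            rw [map_add, hnf, hnf, hnf, ← mul_assoc, hx, add_mul, pow_succ', mul_assoc]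
      | algebraMap c =>
        intro p
        induction p using Finsupp.induction_linear with
        | zero => exact ⟨0, by simp⟩
        | add p p' hp hp' =>
          obtain ⟨s, hs⟩ := hp
          obtain ⟨s', hs'⟩ := hp'
          exact ⟨s + s', by rw [map_add, map_add, hs, hs', mul_add]⟩
        | single i r =>
          exact ⟨Finsupp.single i (algebraMap K R c * r), by
            rw [hnf, hnf, map_mul, mul_assoc, AlgHom.commutes]⟩
      | add u v _ _ hu hv =>
        intro p
        obtain ⟨s, hs⟩ := hu p
        obtain ⟨s', hs'⟩ := hv p
        exact ⟨s + s', by rw [map_add, hs, hs', add_mul]⟩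
      | mul u v _ _ hu hv =>
        intro p
        obtain ⟨s, hs⟩ := hv p
        obtain ⟨s', hs'⟩ := hu s
        exact ⟨s', by rw [hs', hs, mul_assoc]⟩
    intro u
    obtain ⟨p, hp⟩ := hmul u (Finsupp.single 0 1)
    exact ⟨p, by rw [hp, hnf]; simp⟩
  have hG : ∀ (p : ℕ →₀ R) (v : ℕ → R) (j : ℕ),
      G (nf p) v j = p.sum fun i r => r * (oreOp σ δ ^ i) v j := by
    intro p v j
    induction p using Finsupp.induction_linear with
    | zero => simp
    | add p p' hp hp' =>
      rw [map_add, map_add, LinearMap.add_apply, Pi.add_apply, hp, hp', Finsupp.sum_add_index']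
      · simp
      · intros; rw [add_mul]
    | single i r =>
      rw [hnf, map_mul, map_pow, hGf, hGx, Finsupp.sum_single_index (by simp)]
      rfl
  have hG1 : ∀ p : ℕ →₀ R, G (nf p) (Pi.single 0 1) = p := by
    intro p
    funext j
    rw [hG]
    simp only [oreOp_pow_single hδ1]
    rw [Finsupp.sum, Finset.sum_eq_single j]
    · simp
    · intro i _ hij; simp [hij.symm]
    · intro hj; simp [Finsupp.notMem_support_iff.1 hj]
  have htop : ∀ p : ℕ →₀ R, p ≠ 0 → ∃ d, p d ≠ 0 ∧ ∀ i, d < i → p i = 0 := by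
    intro p hp
    have hs := Finsupp.support_nonempty_iff.2 hp
    refine ⟨p.support.max' hs, Finsupp.mem_support_iff.1 (Finset.max'_mem _ hs), fun i hi => ?_⟩
    by_contra h
    exact absurd (Finset.le_max' _ _ (Finsupp.mem_support_iff.2 h)) (not_le.2 hi)
  refine ⟨fun {u v} huv => ?_⟩
  obtain ⟨p, rfl⟩ := hsurj u
  obtain ⟨p', rfl⟩ := hsurj v
  by_contra! hne
  obtain ⟨d, hd, hd'⟩ := htop p (by rintro rfl; simp at hne)
  obtain ⟨e, he, he'⟩ := htop p' (by rintro rfl; simp at hne)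
  -- The leading coefficient of the product is the product of `p d` and a twist of `p' e`.
  have h1 : G (nf p) p' (e + d) = 0 := by
    rw [← hG1 p', ← Module.End.mul_apply, ← map_mul, huv]
    simp
  rw [hG, Finsupp.sum, Finset.sum_eq_single d] at h1
  · rw [(oreOp_pow_top he' d).1] at h1
    rcases mul_eq_zero.1 h1 with h | h
    · exact hd h
    · exact he (hσ.iterate d (by rw [h, iterate_map_zero]))
  · intro i hi hid
    have : i < d := lt_of_le_of_ne (by
      by_contra hlt
      exact Finsupp.mem_support_iff.1 hi (hd' i (not_le.1 hlt))) hid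
    rw [(oreOp_pow_top he' i).2 _ (by omega), mul_zero]
  · intro h
    exact absurd (Finsupp.notMem_support_iff.1 h) hd

end Ore

/-! ### The algebra of quantum matrices has no zero divisors -/

section Domain

variable {K : Type*} [Field K] {q : K} {m n : ℕ}

namespace PartialQMatrix

variable {A : Type*} [Ring A] [Algebra K A] {S : Set (Fin m × Fin n)}

theorem algHom_ext' {f g : PartialQMatrix q S →ₐ[K] A}
    (h : ∀ i j, f (gen q S i j) = g (gen q S i j)) : f = g := by
  refine AlgHom.ext fun r => ?_
  induction r using PartialQMatrix.induction with
  | halg c => rw [AlgHom.commutes, AlgHom.commutes]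
  | hgen i j => exact h i j
  | hadd r s hr hs => rw [map_add, map_add, hr, hs]
  | hmul r s hr hs => rw [map_mul, map_mul, hr, hs]

variable (a : Fin m) (b : Fin n)

/-- The automorphism `σ` of the Ore extension that adjoins the entry in the position `(a, b)`. -/
noncomputable def oreAut : PartialQMatrix q (before a b) →ₐ[K] PartialQMatrix q (before a b) :=
  lift ((isPartialQuantumMatrix_gen q (before a b)).scale (c := oreScale q a b)
    fun i s j l => oreScale_mul_oreScale a b i s j l)

theorem oreAut_gen (i : Fin m) (j : Fin n) : oreAut a b (gen q (before a b) i j)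
    = oreScale q a b i j • gen q (before a b) i j := lift_gen _ i j

theorem oreAut_injective (hq : q ≠ 0) : Function.Injective (oreAut (q := q) a b) := by
  have h := (isPartialQuantumMatrix_gen q (before a b)).scale
    (c := fun i j => (oreScale q a b i j)⁻¹) fun i s j l => by
      rw [← mul_inv, ← mul_inv, oreScale_mul_oreScale]
  have h' : (lift h).comp (oreAut a b) = AlgHom.id K _ := algHom_ext' fun i j => by
    simp [oreAut_gen, oreScale_ne_zero hq]
  intro r s hrs
  have := congrArg (lift h) hrs
  rw [← AlgHom.comp_apply, ← AlgHom.comp_apply, h'] at this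
  exact this

/-- The matrix with the rows `(σ r, δ r)` and `(0, r)`, as an algebra map in `r`. -/
noncomputable def oreTriangular (hq : q ≠ 0) :
    PartialQMatrix q (before a b) →ₐ[K]
      Matrix (Fin 2) (Fin 2) (PartialQMatrix q (before a b)) :=
  lift ((isPartialQuantumMatrix_gen q (before a b)).triangular hq)

theorem oreTriangular_gen (hq : q ≠ 0) (i : Fin m) (j : Fin n) :
    oreTriangular a b hq (gen q (before a b) i j)
      = !![oreScale q a b i j • gen q (before a b) i j,
        oreCorrection q (gen q (before a b)) a b i j; 0, gen q (before a b) i j] := lift_gen _ i j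

/-- The skew derivation `δ` of the Ore extension that adjoins the entry in the position
`(a, b)`. -/
noncomputable def oreDer (hq : q ≠ 0) :
    PartialQMatrix q (before a b) →ₗ[K] PartialQMatrix q (before a b) :=
  (Matrix.entryLinearMap K (PartialQMatrix q (before a b)) (0 : Fin 2) (1 : Fin 2)).comp
    (oreTriangular a b hq).toLinearMap

theorem oreDer_gen (hq : q ≠ 0) (i : Fin m) (j : Fin n) :
    oreDer a b hq (gen q (before a b) i j)
      = oreCorrection q (gen q (before a b)) a b i j := by
  simp [oreDer, oreTriangular_gen]

theorem oreTriangular_apply (hq : q ≠ 0) (r : PartialQMatrix q (before a b)) :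
    oreTriangular a b hq r = !![oreAut a b r, oreDer a b hq r; 0, r] := by
  suffices h : oreTriangular a b hq r 0 0 = oreAut a b r ∧ oreTriangular a b hq r 1 0 = 0 ∧
      oreTriangular a b hq r 1 1 = r by
    ext i j
    fin_cases i <;> fin_cases j
    · exact h.1
    · rfl
    · exact h.2.1
    · exact h.2.2
  induction r using PartialQMatrix.induction with
  | halg c => simp [AlgHom.commutes, Matrix.algebraMap_matrix_apply]
  | hgen i j => simp [oreTriangular_gen, oreAut_gen]
  | hadd r s hr hs => simp [map_add, hr, hs]
  | hmul r s hr hs => simp [map_mul, Matrix.mul_apply, Fin.sum_univ_two, hr, hs]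

theorem oreDer_mul (hq : q ≠ 0) (r s : PartialQMatrix q (before a b)) :
    oreDer a b hq (r * s) = oreAut a b r * oreDer a b hq s + oreDer a b hq r * s := by
  have h := map_mul (oreTriangular a b hq) r s
  rw [oreTriangular_apply, oreTriangular_apply, oreTriangular_apply, triangular_mul] at h
  exact congrFun (congrFun h 0) 1

theorem oreDer_algebraMap (hq : q ≠ 0) (c : K) :
    oreDer a b hq (algebraMap K _ c) = 0 := by
  simp [oreDer, AlgHom.commutes, Matrix.algebraMap_matrix_apply]

variable {a b}

/-- An array on the positions before `(a, b)` is extended to the position `(a, b)` by an element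
that commutes with it like an indeterminate of the Ore extension. -/
theorem isPartialQuantumMatrix_extend (hq : q ≠ 0) (f : PartialQMatrix q (before a b) →ₐ[K] A)
    (y : A) (hy : ∀ i j, y * f (gen q (before a b) i j)
      = f (oreScale q a b i j • gen q (before a b) i j) * y
        + f (oreCorrection q (gen q (before a b)) a b i j)) :
    IsPartialQuantumMatrix q (insert (a, b) (before a b)) fun i j =>
      open Classical in if (i, j) = (a, b) then y else f (gen q (before a b) i j) := by
  classical
  have hg := isPartialQuantumMatrix_gen q (before a b)
  have hlt : ∀ {i : Fin m} {j : Fin n}, (i, j) ∈ before a b → i < a ∨ i = a ∧ j < b := id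
  have hne : ∀ {i : Fin m} {j : Fin n}, (i, j) ∈ before a b → (i, j) ≠ (a, b) := by
    rintro i j h ⟨⟩
    rcases h with h | h
    · exact lt_irrefl _ h
    · exact lt_irrefl _ h.2
  constructor
  · rintro i j l (h₁ | h₁) (h₂ | h₂) h
    · obtain ⟨rfl, rfl⟩ := Prod.mk.inj h₁
      exact absurd h (by simp [(Prod.mk.inj h₂).2])
    · obtain ⟨rfl, rfl⟩ := Prod.mk.inj h₁
      rcases hlt h₂ with h' | h'
      · exact absurd h' (lt_irrefl _)
      · exact absurd h (not_lt.2 h'.2.le)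
    · obtain ⟨rfl, rfl⟩ := Prod.mk.inj h₂
      rw [if_neg (hne h₁), if_pos rfl, hy, oreScale_row h.ne, oreCorrection_of_row]
      simp [hq]
    · rw [if_neg (hne h₁), if_neg (hne h₂), ← map_mul, hg.row _ _ _ h₁ h₂ h, map_smul, map_mul]
  · rintro i s j (h₁ | h₁) (h₂ | h₂) h
    · obtain ⟨rfl, rfl⟩ := Prod.mk.inj h₁
      exact absurd h (by simp [(Prod.mk.inj h₂).1])
    · obtain ⟨rfl, rfl⟩ := Prod.mk.inj h₁
      rcases hlt h₂ with h' | h'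
      · exact absurd h' (not_lt.2 h.le)
      · exact absurd h'.2 (lt_irrefl _)
    · obtain ⟨rfl, rfl⟩ := Prod.mk.inj h₂
      rw [if_neg (hne h₁), if_pos rfl, hy, oreScale_col h.ne, oreCorrection_of_le le_rfl]
      simp [hq]
    · rw [if_neg (hne h₁), if_neg (hne h₂), ← map_mul, hg.col _ _ _ h₁ h₂ h, map_smul, map_mul]
  · rintro i s j l (h₁ | h₁) (h₂ | h₂) h h'
    · obtain ⟨rfl, rfl⟩ := Prod.mk.inj h₁
      exact absurd h (by simp [(Prod.mk.inj h₂).1])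
    · obtain ⟨rfl, rfl⟩ := Prod.mk.inj h₁
      rw [if_neg (hne h₂), if_pos rfl, hy, oreScale_of_ne h.ne h'.ne',
        oreCorrection_of_le h'.le]
      simp
    · obtain ⟨rfl, rfl⟩ := Prod.mk.inj h₂
      rcases hlt h₁ with h'' | h''
      · exact absurd h'' (not_lt.2 h.le)
      · exact absurd h''.1 h.ne'
    · rw [if_neg (hne h₁), if_neg (hne h₂), ← map_mul, hg.anti _ _ _ _ h₁ h₂ h h', map_mul]
  · rintro i s j l (h₁ | h₁) (h₂ | h₂) h h'
    · obtain ⟨rfl, rfl⟩ := Prod.mk.inj h₁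
      exact absurd h (by simp [(Prod.mk.inj h₂).1])
    · obtain ⟨rfl, rfl⟩ := Prod.mk.inj h₁
      rcases hlt h₂ with h'' | h''
      · exact absurd h'' (not_lt.2 h.le)
      · exact absurd h''.1 h.ne'
    · obtain ⟨rfl, rfl⟩ := Prod.mk.inj h₂
      rw [if_neg (hne h₁), if_pos rfl, hy, oreScale_of_ne h.ne h'.ne, oreCorrection_of_lt h h',
        if_neg (by simp [h.ne]), if_neg (by simp [h'.ne])]
      simp only [one_smul, map_smul, map_mul, sub_add_cancel_left, neg_smul, neg_neg]
    · have hi : i < a := by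
        rcases hlt h₂ with h'' | h''
        · exact h.trans h''
        · exact h''.1 ▸ h
      have hj : ¬ (s, j) = (a, b) := by
        rintro ⟨⟩
        rcases hlt h₂ with h'' | h''
        · exact lt_irrefl _ h''
        · exact lt_asymm h''.2 h'
      rw [if_neg (hne h₁), if_neg (hne h₂), if_neg (by simp [hi.ne]), if_neg hj, ← map_mul,
        ← map_mul, ← map_sub, hg.diag _ _ _ _ h₁ h₂ h h', map_smul, map_mul]
  · intro i j h
    rw [Set.mem_insert_iff, not_or] at h
    rw [if_neg h.1, hg.zero _ _ h.2, map_zero]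

/-- The entries of a partial quantum matrix in the positions before `(a, b)`. -/
theorem isPartialQuantumMatrix_restrict {x : Fin m → Fin n → A}
    (hx : IsPartialQuantumMatrix q (insert (a, b) (before a b)) x) :
    IsPartialQuantumMatrix q (before a b) fun i j =>
      open Classical in if (i, j) ∈ before a b then x i j else 0 := by
  classical
  have hlt : ∀ {i : Fin m} {j : Fin n}, (i, j) ∈ before a b → i < a ∨ i = a ∧ j < b := id
  constructor
  · intro i j l h₁ h₂ h
    rw [if_pos h₁, if_pos h₂, hx.row _ _ _ (Or.inr h₁) (Or.inr h₂) h]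
  · intro i s j h₁ h₂ h
    rw [if_pos h₁, if_pos h₂, hx.col _ _ _ (Or.inr h₁) (Or.inr h₂) h]
  · intro i s j l h₁ h₂ h h'
    rw [if_pos h₁, if_pos h₂, hx.anti _ _ _ _ (Or.inr h₁) (Or.inr h₂) h h']
  · intro i s j l h₁ h₂ h h'
    have h₃ : (i, l) ∈ before a b := by
      rcases hlt h₂ with h'' | h''
      · exact Or.inl (h.trans h'')
      · exact Or.inl (h''.1 ▸ h)
    have h₄ : (s, j) ∈ before a b := by
      rcases hlt h₂ with h'' | h''
      · exact Or.inl h''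
      · exact Or.inr ⟨h''.1, h'.trans h''.2⟩
    rw [if_pos h₁, if_pos h₂, if_pos h₃, if_pos h₄,
      hx.diag _ _ _ _ (Or.inr h₁) (Or.inr h₂) h h']
  · intro i j h
    rw [if_neg h]

/-- The commutation rule of the Ore extension holds between the entry in the position `(a, b)` and the
entries before it. -/
theorem gen_mul_gen (hq : q ≠ 0) {x : Fin m → Fin n → A}
    (hx : IsPartialQuantumMatrix q (insert (a, b) (before a b)) x) {i : Fin m} {j : Fin n}
    (h : (i, j) ∈ before a b) :
    x a b * x i j = oreScale q a b i j • x i j * x a b + oreCorrection q x a b i j := by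
  have hab : (a, b) ∈ insert (a, b) (before a b) := Or.inl rfl
  have h' : i < a ∨ i = a ∧ j < b := h
  rcases h' with hi | ⟨rfl, hj⟩
  · rcases lt_trichotomy j b with hj | rfl | hj
    · have e := hx.diag i a j b (Or.inr h) hab hi hj
      rw [oreScale_of_ne hi.ne hj.ne, oreCorrection_of_lt hi hj, one_smul, neg_smul, ← e]
      abel
    · rw [oreScale_col hi.ne, oreCorrection_of_le le_rfl, smul_mul_assoc,
        hx.col i a j (Or.inr h) hab hi]
      simp [hq]
    · rw [oreScale_of_ne hi.ne hj.ne', oreCorrection_of_le hj.le, one_smul, add_zero,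
        hx.anti a i b j hab (Or.inr h) hi hj]
  · rw [oreScale_row hj.ne, oreCorrection_of_row, smul_mul_assoc,
      hx.row i j b (Or.inr h) hab hj]
    simp [hq]

theorem noZeroDivisors_insert (hq : q ≠ 0) (a : Fin m) (b : Fin n)
    [NoZeroDivisors (PartialQMatrix q (before a b))] :
    NoZeroDivisors (PartialQMatrix q (insert (a, b) (before a b))) := by
  classical
  set T := insert (a, b) (before a b)
  have hg := isPartialQuantumMatrix_gen q T
  let f : PartialQMatrix q (before a b) →ₐ[K] PartialQMatrix q T :=
    lift (isPartialQuantumMatrix_restrict hg)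
  have hf : ∀ {i j}, (i, j) ∈ before a b → f (gen q (before a b) i j) = gen q T i j := by
    intro i j h
    simp only [f, lift_gen, if_pos h]
  have hx : ∀ r, gen q T a b * f r = f (oreAut a b r) * gen q T a b + f (oreDer a b hq r) := by
    intro r
    induction r using PartialQMatrix.induction with
    | halg c =>
      rw [oreDer_algebraMap, AlgHom.commutes, AlgHom.commutes, AlgHom.commutes, map_zero, add_zero,
        Algebra.commutes]
    | hgen i j =>
      by_cases h : (i, j) ∈ before a b
      · rw [oreAut_gen, oreDer_gen, map_smul, hf h, gen_mul_gen hq hg h]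
        congr 1
        unfold oreCorrection
        split_ifs with h'
        · rw [map_smul, map_mul, hf (mem_before_of_lt h'.1 _), hf (mem_before_of_lt_right h'.2)]
        · rw [map_zero]
      · rw [(isPartialQuantumMatrix_gen q (before a b)).zero i j h]
        simp
    | hadd r s hr hs =>
      rw [map_add, map_add, map_add, map_add, map_add, mul_add, hr, hs]
      noncomm_ring
    | hmul r s hr hs =>
      rw [oreDer_mul, map_mul, map_mul, map_mul, map_add, map_mul, map_mul, ← mul_assoc, hr,
        add_mul, mul_assoc, hs]
      noncomm_ring
  have hG := isPartialQuantumMatrix_extend hq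
    (Algebra.lsmul K K (ℕ → PartialQMatrix q (before a b)))
    (oreOp (oreAut a b) (oreDer a b hq)) fun i j => by
      rw [oreOp_mul_lsmul (oreDer_mul a b hq), oreAut_gen, oreDer_gen]
  let act : PartialQMatrix q (before a b) →ₐ[K]
      Module.End K (ℕ → PartialQMatrix q (before a b)) := Algebra.lsmul K K _
  let G : PartialQMatrix q T →ₐ[K] Module.End K (ℕ → PartialQMatrix q (before a b)) := lift hG
  refine noZeroDivisors_of_ore (oreAut_injective a b hq) (oreDer_mul a b hq) f (gen q T a b) hx ?_
    G ?_ ?_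
  · refine eq_top_iff.2 fun u _ => ?_
    induction u using PartialQMatrix.induction with
    | halg c => exact Subalgebra.algebraMap_mem _ c
    | hgen i j =>
      by_cases h : (i, j) ∈ T
      · rcases h with h | h
        · obtain ⟨rfl, rfl⟩ := Prod.mk.inj h
          exact Algebra.subset_adjoin (Or.inr rfl)
        · exact Algebra.subset_adjoin (Or.inl ⟨_, hf h⟩)
      · rw [hg.zero i j h]
        exact Subalgebra.zero_mem _
    | hadd r s hr hs => exact Subalgebra.add_mem _ (hr trivial) (hs trivial)
    | hmul r s hr hs => exact Subalgebra.mul_mem _ (hr trivial) (hs trivial)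
  · intro r
    have : G.comp f = act := by
      refine algHom_ext' (A := Module.End K (ℕ → PartialQMatrix q (before a b))) fun i j => ?_
      by_cases h : (i, j) ∈ before a b
      · have hne : ¬ (i, j) = (a, b) := by
          rintro ⟨⟩
          rcases h with h | h
          · exact lt_irrefl _ h
          · exact lt_irrefl _ h.2
        rw [AlgHom.comp_apply, hf h, lift_gen, if_neg hne]
      · rw [(isPartialQuantumMatrix_gen q (before a b)).zero i j h, map_zero, map_zero]
    exact DFunLike.congr_fun this r
  · rw [lift_gen, if_pos rfl]

/-- The order of reading is the order of the numbers `j + n * i`. -/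
theorem before_eq (a : Fin m) (b : Fin n) :
    before a b = {p | (finProdFinEquiv p : ℕ) < finProdFinEquiv (a, b)} := by
  ext ⟨i, j⟩
  simp only [before, Set.mem_ofPred_eq, finProdFinEquiv_apply_val, Fin.lt_def, Fin.ext_iff]
  have hj := j.isLt
  have hb := b.isLt
  constructor
  · rintro (h | ⟨h, h'⟩)
    · nlinarith [Nat.mul_le_mul_left n (Nat.succ_le_of_lt h)]
    · rw [h]; omega
  · intro h
    rcases lt_trichotomy i.val a.val with h' | h' | h'
    · exact Or.inl h'
    · rw [h'] at h
      exact Or.inr ⟨h', by omega⟩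
    · nlinarith [Nat.mul_le_mul_left n (Nat.succ_le_of_lt h')]

theorem noZeroDivisors_of_lt (hq : q ≠ 0) (t : ℕ) (ht : t ≤ m * n) :
    NoZeroDivisors (PartialQMatrix q
      {p : Fin m × Fin n | (finProdFinEquiv p : ℕ) < t}) := by
  induction t with
  | zero =>
    have hg := isPartialQuantumMatrix_gen q {p : Fin m × Fin n | (finProdFinEquiv p : ℕ) < 0}
    have hscalar : ∀ u : PartialQMatrix q {p : Fin m × Fin n | (finProdFinEquiv p : ℕ) < 0},
        ∃ c : K, algebraMap K _ c = u := by
      intro u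
      induction u using PartialQMatrix.induction with
      | halg c => exact ⟨c, rfl⟩
      | hgen i j => exact ⟨0, by rw [map_zero, hg.zero i j (by simp)]⟩
      | hadd r s hr hs =>
        obtain ⟨c, rfl⟩ := hr
        obtain ⟨d, rfl⟩ := hs
        exact ⟨c + d, map_add _ _ _⟩
      | hmul r s hr hs =>
        obtain ⟨c, rfl⟩ := hr
        obtain ⟨d, rfl⟩ := hs
        exact ⟨c * d, map_mul _ _ _⟩
    refine ⟨fun {u v} huv => ?_⟩
    obtain ⟨c, rfl⟩ := hscalar u
    obtain ⟨d, rfl⟩ := hscalar v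
    by_cases hc : c = 0
    · left; rw [hc, map_zero]
    · right
      have := congrArg (c⁻¹ • ·) huv
      simpa [Algebra.algebraMap_eq_smul_one, smul_smul, hc] using this
  | succ t ih =>
    obtain ⟨⟨a, b⟩, hab⟩ := finProdFinEquiv.surjective (⟨t, ht⟩ : Fin (m * n))
    have hab' : (finProdFinEquiv (a, b) : ℕ) = t := by rw [hab]
    have h := ih (by omega)
    rw [← hab', ← before_eq] at h
    have h2 := noZeroDivisors_insert hq a b
    have h3 : insert (a, b) (before a b)
        = {p : Fin m × Fin n | (finProdFinEquiv p : ℕ) < t + 1} := by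
      rw [before_eq]
      ext p
      have : p = (a, b) ↔ (finProdFinEquiv p : ℕ) = finProdFinEquiv (a, b) := by
        rw [← Fin.ext_iff, EmbeddingLike.apply_eq_iff_eq]
      simp only [Set.mem_insert_iff, Set.mem_ofPred_eq, this]
      omega
    rwa [h3] at h2

end PartialQMatrix

namespace QMatrix

variable {A : Type*} [Ring A] [Algebra K A]

theorem isQuantumMatrix_x (q : K) (m n : ℕ) :
    IsQuantumMatrix q fun (i : Fin m) (j : Fin n) => x q i j where
  row i j l h := by
    simpa [x] using RingQuot.mkAlgHom_rel K (QMatrixRel.row (q := q) i j l h)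
  col i s j h := by
    simpa [x] using RingQuot.mkAlgHom_rel K (QMatrixRel.col (q := q) i s j h)
  anti i s j l h h' := by
    simpa [x] using RingQuot.mkAlgHom_rel K (QMatrixRel.anti (q := q) i s j l h h')
  diag i s j l h h' := by
    have := RingQuot.mkAlgHom_rel K (QMatrixRel.diag (q := q) i s j l h h')
    rw [map_sub, map_smul, map_mul, map_mul, map_mul] at this
    exact this

/-- The algebra map out of `O_q(M(m,n))` given by an array that satisfies its relations. -/
noncomputable def lift {y : Fin m → Fin n → A} (hy : IsQuantumMatrix q y) :
    QMatrix q m n →ₐ[K] A :=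
  RingQuot.liftAlgHom K ⟨FreeAlgebra.lift K fun p => y p.1 p.2, by
    rintro _ _ (⟨i, j, l, h⟩ | ⟨i, s, j, h⟩ | ⟨i, s, j, l, h, h'⟩ | ⟨i, s, j, l, h, h'⟩)
    · simpa using hy.row i j l h
    · simpa using hy.col i s j h
    · simpa using hy.anti i s j l h h'
    · rw [map_sub, map_smul, map_mul, map_mul, map_mul]
      simpa only [FreeAlgebra.lift_ι_apply] using hy.diag i s j l h h'⟩

@[simp]
theorem lift_x {y : Fin m → Fin n → A} (hy : IsQuantumMatrix q y) (i : Fin m) (j : Fin n) :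
    lift hy (x q i j) = y i j := by
  simp [lift, x]

theorem induction {P : QMatrix q m n → Prop} (halg : ∀ c : K, P (algebraMap K _ c))
    (hgen : ∀ i j, P (x q i j)) (hadd : ∀ a b, P a → P b → P (a + b))
    (hmul : ∀ a b, P a → P b → P (a * b)) (a : QMatrix q m n) : P a := by
  obtain ⟨a, rfl⟩ := RingQuot.mkAlgHom_surjective K (QMatrixRel q m n) a
  induction a using FreeAlgebra.induction with
  | grade0 c => simpa using halg c
  | grade1 p => exact hgen p.1 p.2
  | mul a b ha hb => rw [map_mul]; exact hmul _ _ ha hb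
  | add a b ha hb => rw [map_add]; exact hadd _ _ ha hb

theorem algHom_ext' {f g : QMatrix q m n →ₐ[K] A} (h : ∀ i j, f (x q i j) = g (x q i j)) :
    f = g := by
  refine AlgHom.ext fun r => ?_
  induction r using QMatrix.induction with
  | halg c => rw [AlgHom.commutes, AlgHom.commutes]
  | hgen i j => exact h i j
  | hadd r s hr hs => rw [map_add, map_add, hr, hs]
  | hmul r s hr hs => rw [map_mul, map_mul, hr, hs]

/-- The algebra of quantum matrices has no zero divisors. -/
theorem noZeroDivisors (hq : q ≠ 0) (m n : ℕ) : NoZeroDivisors (QMatrix q m n) := by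
  have h := PartialQMatrix.noZeroDivisors_of_lt (m := m) (n := n) hq (m * n) le_rfl
  have hS : {p : Fin m × Fin n | (finProdFinEquiv p : ℕ) < m * n} = Set.univ := by
    ext p
    exact ⟨fun _ => trivial, fun _ => (finProdFinEquiv p).isLt⟩
  rw [hS] at h
  have hx := isQuantumMatrix_x q m n
  have hg := PartialQMatrix.isPartialQuantumMatrix_gen q (Set.univ : Set (Fin m × Fin n))
  let f : QMatrix q m n →ₐ[K] PartialQMatrix q (Set.univ : Set (Fin m × Fin n)) :=
    lift (y := PartialQMatrix.gen q Set.univ)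
      ⟨fun i j l => hg.row i j l trivial trivial, fun i s j => hg.col i s j trivial trivial,
        fun i s j l => hg.anti i s j l trivial trivial,
        fun i s j l => hg.diag i s j l trivial trivial⟩
  let g : PartialQMatrix q (Set.univ : Set (Fin m × Fin n)) →ₐ[K] QMatrix q m n :=
    PartialQMatrix.lift (x := fun i j => x q i j)
      ⟨fun i j l _ _ => hx.row i j l, fun i s j _ _ => hx.col i s j,
        fun i s j l _ _ => hx.anti i s j l, fun i s j l _ _ => hx.diag i s j l,
        fun i j h => absurd trivial h⟩
  have hgf : g.comp f = AlgHom.id K _ := algHom_ext' fun i j => by simp [f, g]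
  have hinj : Function.Injective f := by
    intro r s hrs
    have := congrArg g hrs
    rwa [← AlgHom.comp_apply, ← AlgHom.comp_apply, hgf] at this
  exact hinj.noZeroDivisors f (map_zero f) (map_mul f)

end QMatrix

end Domain

/-! ### The R-matrix and the adjugate -/

section RMatrix

variable {K : Type*} [Field K] {q : K} {A : Type*} [Ring A] [Algebra K A] {N : ℕ}

/-- The relations of quantum matrices say that the tensor square of the matrix commutes with the
`R`-matrix of type `A`. -/
theorem isQuantumMatrix_iff (hq : q ≠ 0) {x : Fin N → Fin N → A} :
    IsQuantumMatrix q x ↔ ∀ i s j l,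
      (if i = s then q • (x i j * x s l)
        else x s j * x i l + if i < s then (q - q⁻¹) • (x i j * x s l) else 0)
      = if j = l then q • (x i j * x s l)
        else x i l * x s j + if j < l then (q - q⁻¹) • (x i j * x s l) else 0 := by
  constructor
  · intro hx i s j l
    rcases lt_trichotomy i s with his | rfl | his <;>
      rcases lt_trichotomy j l with hjl | rfl | hjl
    · rw [if_neg his.ne, if_neg hjl.ne, if_pos his, if_pos hjl, hx.anti s i j l his hjl]
    · rw [if_neg his.ne, if_pos rfl, if_pos his, hx.col i s j his]
      match_scalars; field_simp; ring
    · rw [if_neg his.ne, if_neg hjl.ne', if_pos his, if_neg hjl.not_gt, add_zero,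
        ← hx.diag i s l j his hjl]
      abel
    · rw [if_pos rfl, if_neg hjl.ne, if_pos hjl, hx.row i j l hjl]
      match_scalars; field_simp; ring
    · rw [if_pos rfl, if_pos rfl]
    · rw [if_pos rfl, if_neg hjl.ne', if_neg hjl.not_gt, add_zero, hx.row i l j hjl]
    · rw [if_neg his.ne', if_neg hjl.ne, if_neg his.not_gt, if_pos hjl, add_zero,
        hx.anti i s j l his hjl, ← hx.diag s i j l his hjl]
      abel
    · rw [if_neg his.ne', if_pos rfl, if_neg his.not_gt, add_zero, hx.col s i j his]
    · rw [if_neg his.ne', if_neg hjl.ne', if_neg his.not_gt, if_neg hjl.not_gt, add_zero,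
        add_zero, hx.anti i s l j his hjl]
  · intro h
    constructor
    · intro i j l hjl
      have := h i i l j
      rw [if_pos rfl, if_neg hjl.ne', if_neg hjl.not_gt, add_zero] at this
      exact this.symm
    · intro i s j his
      have := h s i j j
      rw [if_pos rfl, if_neg his.ne', if_neg his.not_gt, add_zero] at this
      exact this
    · intro i s j l his hjl
      have := h s i j l
      rw [if_neg his.ne, if_neg hjl.ne, if_pos his, if_pos hjl] at this
      exact add_right_cancel this
    · intro i s j l his hjl
      have := h i s l j
      rw [if_neg his.ne, if_neg hjl.ne', if_pos his, if_neg hjl.not_gt, add_zero] at this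
      rw [← this]
      abel

/-- The `R`-matrix of type `A`, with rows and columns indexed by pairs and with scalar entries in the
algebra `A`; it includes the flip of the two tensor factors. -/
def rMatrix (q : K) (A : Type*) [Ring A] [Algebra K A] (N : ℕ) :
    Matrix (Fin N × Fin N) (Fin N × Fin N) A := fun p r =>
  algebraMap K A (if p.1 = p.2 then (if p = r then q else 0)
    else (if p.swap = r then 1 else 0) + if p.1 < p.2 then (if p = r then q - q⁻¹ else 0) else 0)

theorem rMatrix_mul_apply (M : Matrix (Fin N × Fin N) (Fin N × Fin N) A) (i s : Fin N)
    (r : Fin N × Fin N) :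
    (rMatrix q A N * M) (i, s) r
      = if i = s then q • M (i, s) r
        else M (s, i) r + if i < s then (q - q⁻¹) • M (i, s) r else 0 := by
  rw [Matrix.mul_apply]
  simp only [rMatrix, ← Algebra.smul_def]
  split_ifs <;> simp [add_smul, ite_smul, Finset.sum_add_distrib]

theorem mul_rMatrix_apply (M : Matrix (Fin N × Fin N) (Fin N × Fin N) A) (p : Fin N × Fin N)
    (j l : Fin N) :
    (M * rMatrix q A N) p (j, l)
      = if j = l then q • M p (j, l)
        else M p (l, j) + if j < l then (q - q⁻¹) • M p (j, l) else 0 := by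
  have hsymm : ∀ r, rMatrix q A N r (j, l) = rMatrix q A N (j, l) r := by
    rintro ⟨i, s⟩
    simp only [rMatrix, Prod.mk.injEq, Prod.swap_prod_mk]
    congr 1
    by_cases h1 : i = j <;> by_cases h2 : s = l <;> by_cases h3 : i = l <;> by_cases h4 : s = j <;>
      simp_all [eq_comm]
  rw [Matrix.mul_apply]
  simp only [hsymm]
  simp only [rMatrix, ← Algebra.commutes, ← Algebra.smul_def]
  split_ifs <;> simp [add_smul, ite_smul, Finset.sum_add_distrib]

/-- The inverse of a quantum matrix, up to a central regular element, is a quantum matrix over the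
opposite algebra. -/
theorem IsQuantumMatrix.op_of_adjugate (hq : q ≠ 0) {x y : Fin N → Fin N → A}
    (hx : IsQuantumMatrix q x) {D : A} (hD : ∀ u v : A, D * u = D * v → u = v)
    (hDy : ∀ u, Commute D u)
    (hxy : ∀ i j, ∑ l, x i l * y l j = if i = j then D else 0)
    (hyx : ∀ i j, ∑ l, y i l * x l j = if i = j then D else 0) :
    IsQuantumMatrix q fun i j => MulOpposite.op (y i j) := by
  set T : Matrix (Fin N × Fin N) (Fin N × Fin N) A := fun p r => x p.1 r.1 * x p.2 r.2 with hT
  set U : Matrix (Fin N × Fin N) (Fin N × Fin N) A := fun p r => y p.2 r.2 * y p.1 r.1 with hU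
  have hRT : rMatrix q A N * T = T * rMatrix q A N := by
    refine Matrix.ext fun ⟨i, s⟩ ⟨j, l⟩ => ?_
    rw [rMatrix_mul_apply, mul_rMatrix_apply]
    exact (isQuantumMatrix_iff hq).1 hx i s j l
  have hTU : T * U = Matrix.diagonal fun _ => D * D := by
    refine Matrix.ext fun ⟨i, s⟩ ⟨j, l⟩ => ?_
    rw [Matrix.mul_apply, Fintype.sum_prod_type]
    have : ∀ a, ∑ b, T (i, s) (a, b) * U (a, b) (j, l)
        = x i a * (∑ b, x s b * y b l) * y a j := by
      intro a
      simp only [hT, hU, Finset.mul_sum, Finset.sum_mul, mul_assoc]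
    simp only [this, hxy]
    by_cases hs : s = l
    · simp only [if_pos hs]
      have h2 : ∀ a, x i a * D * y a j = D * (x i a * y a j) := fun a => by
        rw [← (hDy (x i a)).eq, mul_assoc]
      simp only [h2, ← Finset.mul_sum, hxy]
      by_cases hi : i = j <;> simp [hi, hs]
    · simp [hs]
  have hUT : U * T = Matrix.diagonal fun _ => D * D := by
    refine Matrix.ext fun ⟨i, s⟩ ⟨j, l⟩ => ?_
    rw [Matrix.mul_apply, Fintype.sum_prod_type, Finset.sum_comm]
    have : ∀ b, ∑ a, U (i, s) (a, b) * T (a, b) (j, l)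
        = y s b * (∑ a, y i a * x a j) * x b l := by
      intro a
      simp only [hT, hU, Finset.mul_sum, Finset.sum_mul, mul_assoc]
    simp only [this, hyx]
    by_cases hi : i = j
    · simp only [if_pos hi]
      have h2 : ∀ a, y s a * D * x a l = D * (y s a * x a l) := fun a => by
        rw [← (hDy (y s a)).eq, mul_assoc]
      simp only [h2, ← Finset.mul_sum, hyx]
      by_cases hs : s = l <;> simp [hi, hs]
    · simp [hi]
  -- Multiply `R T = T R` by `U` on both sides and cancel `D ^ 2`.
  have hRU : rMatrix q A N * U = U * rMatrix q A N := by
    have h : (U * rMatrix q A N) * (T * U) = (U * T) * (rMatrix q A N * U) := by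
      simp only [Matrix.mul_assoc]
      rw [← Matrix.mul_assoc T, ← hRT, Matrix.mul_assoc]
    rw [hTU, hUT] at h
    refine Matrix.ext fun p r => ?_
    have h2 := congrFun (congrFun h p) r
    rw [Matrix.mul_diagonal, Matrix.diagonal_mul, ← ((hDy _).mul_left (hDy _)).eq, mul_assoc,
      mul_assoc] at h2
    exact (hD _ _ (hD _ _ h2)).symm
  rw [isQuantumMatrix_iff hq]
  intro i s j l
  have h := congrFun (congrFun hRU (i, s)) (j, l)
  rw [rMatrix_mul_apply, mul_rMatrix_apply] at h
  have h2 := congrArg MulOpposite.op h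
  simp only [hU, apply_ite MulOpposite.op, MulOpposite.op_add, MulOpposite.op_smul,
    MulOpposite.op_mul, MulOpposite.op_zero] at h2
  exact h2

/-- Reversing the order of both index sets and transposing turns a quantum matrix over the opposite
algebra into a quantum matrix. -/
theorem IsQuantumMatrix.rev_of_op {y : Fin N → Fin N → A}
    (hy : IsQuantumMatrix q fun i j => MulOpposite.op (y i j)) :
    IsQuantumMatrix q fun i j : Fin N => y j.rev i.rev where
  row i j l h := MulOpposite.op_injective (by
    simpa using hy.col l.rev j.rev i.rev (Fin.rev_lt_rev.2 h))
  col i s j h := MulOpposite.op_injective (by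
    simpa using hy.row j.rev s.rev i.rev (Fin.rev_lt_rev.2 h))
  anti i s j l h h' := MulOpposite.op_injective (by
    simpa using (hy.anti j.rev l.rev i.rev s.rev (Fin.rev_lt_rev.2 h')
      (Fin.rev_lt_rev.2 h)).symm)
  diag i s j l h h' := MulOpposite.op_injective (by
    have h1 := hy.diag l.rev j.rev s.rev i.rev (Fin.rev_lt_rev.2 h') (Fin.rev_lt_rev.2 h)
    rw [← hy.anti j.rev l.rev s.rev i.rev (Fin.rev_lt_rev.2 h') (Fin.rev_lt_rev.2 h)] at h1
    simpa using h1)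

end RMatrix

section QuantumDet

variable {K : Type*} [Field K] {q : K} {A : Type*} [Ring A] [Algebra K A] {t : ℕ}

theorem map_quantumDet {B : Type*} [Ring B] [Algebra K B] (f : A →ₐ[K] B)
    (a : Fin t → Fin t → A) : f (quantumDet q a) = quantumDet q fun i j => f (a i j) := by
  simp only [quantumDet, map_sum, map_smul, map_list_prod, List.map_ofFn]
  rfl

theorem prod_ofFn_central_mul {M : Type*} [Monoid M] (u g : Fin t → M)
    (hu : ∀ i a, Commute (u i) a) :
    (List.ofFn fun i => u i * g i).prod = (List.ofFn u).prod * (List.ofFn g).prod := by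
  induction t with
  | zero => simp
  | succ t ih =>
    simp only [List.ofFn_succ, List.prod_cons]
    rw [ih (fun i => u i.succ) (fun i => g i.succ) fun i => hu i.succ]
    have h : Commute (List.ofFn fun i : Fin t => u i.succ).prod (g 0) :=
      Commute.list_prod_left _ _ fun z hz => by
        obtain ⟨i, rfl⟩ := List.mem_ofFn.1 hz
        exact hu _ _
    simp only [mul_assoc]
    rw [← mul_assoc (g 0), ← h.eq, mul_assoc]

theorem quantumDet_central_mul (u : Fin t → A) (hu : ∀ i a, Commute (u i) a)
    (a : Fin t → Fin t → A) :
    quantumDet q (fun i j => u i * a i j) = (List.ofFn u).prod * quantumDet q a := by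
  simp only [quantumDet, Finset.mul_sum, mul_smul_comm]
  exact Finset.sum_congr rfl fun σ _ => by rw [prod_ofFn_central_mul u _ hu]

theorem prod_ofFn_smul (c : Fin t → K) (g : Fin t → A) :
    (List.ofFn fun i => c i • g i).prod = (∏ i, c i) • (List.ofFn g).prod := by
  induction t with
  | zero => simp
  | succ t ih =>
    simp only [List.ofFn_succ, List.prod_cons, Fin.prod_univ_succ]
    rw [ih (fun i => c i.succ), smul_mul_smul_comm]

theorem quantumDet_smul (c : Fin t → K) (a : Fin t → Fin t → A) :
    quantumDet q (fun i j => c j • a i j) = (∏ j, c j) • quantumDet q a := by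
  simp only [quantumDet, Finset.smul_sum]
  refine Finset.sum_congr rfl fun σ _ => ?_
  rw [prod_ofFn_smul (fun i => c (σ i)), Equiv.prod_comp σ c, smul_comm]

theorem IsQuantumMatrix.central_mul {ι κ : Type*} [LT ι] [LT κ] {x : ι → κ → A}
    (hx : IsQuantumMatrix q x) (u : ι → A) (hu : ∀ i a, Commute (u i) a) :
    IsQuantumMatrix q fun i j => u i * x i j := by
  have h : ∀ i s a b, u i * a * (u s * b) = u i * u s * (a * b) := fun i s a b => by
    rw [mul_assoc, ← mul_assoc a, ← (hu s a).eq]; simp only [mul_assoc]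
  constructor
  · intro i j l hjl
    rw [h, h, hx.row _ _ _ hjl, mul_smul_comm]
  · intro i s j his
    rw [h, h, hx.col _ _ _ his, mul_smul_comm, (hu i (u s)).eq]
  · intro i s j l his hjl
    rw [h, h, hx.anti _ _ _ _ his hjl, (hu i (u s)).eq]
  · intro i s j l his hjl
    rw [h, h, h, (hu s (u i)).eq, ← mul_sub, hx.diag _ _ _ _ his hjl, mul_smul_comm]

theorem IsQuantumMatrix.smul_col {ι κ : Type*} [LT ι] [LT κ] {x : ι → κ → A}
    (hx : IsQuantumMatrix q x) (c : κ → K) :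
    IsQuantumMatrix q fun i j => c j • x i j where
  row i j l h := by
    simp only [smul_mul_smul_comm, hx.row _ _ _ h]
    module
  col i s j h := by
    simp only [smul_mul_smul_comm, hx.col _ _ _ h]
    module
  anti i s j l h h' := by
    simp only [smul_mul_smul_comm, hx.anti _ _ _ _ h h']
    module
  diag i s j l h h' := by
    have := hx.diag _ _ _ _ h h'
    rw [sub_eq_iff_eq_add] at this
    simp only [smul_mul_smul_comm, this]
    module

theorem isQuantumMatrix_one (q : K) (N : ℕ) :
    IsQuantumMatrix q fun i j : Fin N => if i = j then (1 : K) else 0 where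
  row i j l h := by
    rcases eq_or_ne i j with rfl | h1
    · simp [h.ne]
    · simp [h1]
  col i s j h := by
    rcases eq_or_ne i j with rfl | h1
    · simp [h.ne']
    · simp [h1]
  anti i s j l h h' := mul_comm _ _
  diag i s j l h h' := by
    have : ¬ (i = l ∧ s = j) := by
      rintro ⟨rfl, rfl⟩
      exact lt_asymm h h'
    rw [mul_comm, sub_self]
    by_cases h1 : i = l <;> by_cases h2 : s = j <;> simp_all

theorem quantumDet_one (q : K) (N : ℕ) :
    quantumDet q (fun i j : Fin N => if i = j then (1 : K) else 0) = 1 := by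
  rw [quantumDet, Finset.sum_eq_single 1]
  · have h : permLength (1 : Equiv.Perm (Fin N)) = 0 := by
      rw [permLength_eq_invCount]
      exact invCount_of_strictMono strictMono_id
    simp [h]
  · intro σ _ hσ
    obtain ⟨i, hi⟩ := not_forall.1 fun h => hσ (Equiv.ext h)
    rw [List.prod_eq_zero, smul_zero]
    exact List.mem_ofFn.2 ⟨i, if_neg fun h => hi h.symm⟩
  · simp

theorem quantumDet_x_ne_zero (q : K) (N : ℕ) :
    quantumDet q (fun i j : Fin N => QMatrix.x q i j) ≠ 0 := by
  intro h
  have h2 := congrArg (QMatrix.lift (isQuantumMatrix_one q N)) h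
  rw [map_quantumDet, map_zero] at h2
  simp only [QMatrix.lift_x, quantumDet_one] at h2
  exact one_ne_zero h2

theorem commute_quantumDet_x (hq : q ≠ 0) (N : ℕ) (u : QMatrix q N N) :
    Commute (quantumDet q fun i j : Fin N => QMatrix.x q i j) u := by
  induction u using QMatrix.induction with
  | halg c => exact (Algebra.commutes c _).symm
  | hgen i j => exact commute_quantumDet hq (QMatrix.isQuantumMatrix_x q N N) i j
  | hadd r s hr hs => exact hr.add_right hs
  | hmul r s hr hs => exact hr.mul_right hs

end QuantumDet

/-! ### The duality of quantum grassmannians -/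

open Polynomial

section ScalingPolynomials

variable {K : Type*} [Field K] {A : Type*} [Ring A] [Algebra K A]

/-- Substituting `d X` for the variable `X` is injective if `d` is a central regular element. -/
theorem exists_algHom_X_mul (d : A) (hd : ∀ a, Commute d a) (hreg : ∀ a, a * d = 0 → a = 0) :
    ∃ Ψ : A[X] →ₐ[K] A[X], Function.Injective Ψ ∧ Ψ X = X * C d ∧ ∀ a, Ψ (C a) = C a := by
  have hcomm : ∀ p : A[X], Commute p (X * C d) := fun p =>
    (commute_X p).symm.mul_right (by
      induction p using Polynomial.induction_on' with
      | add p p' hp hp' => exact hp.add_left hp'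
      | monomial i a =>
        rw [← C_mul_X_pow_eq_monomial]
        refine Commute.mul_left ?_ ((commute_X (C d)).pow_left i)
        rw [Commute, SemiconjBy, ← C_mul, ← C_mul, (hd a).eq])
  let Ψ : A[X] →ₐ[K] A[X] := eval₂AlgHom (CAlgHom (R := K)) (X * C d) fun a => hcomm _
  have hC : ∀ a, Ψ (C a) = C a := fun a => eval₂_C _ _
  have hX : Ψ X = X * C d := eval₂_X _ _
  have hpow : ∀ i : ℕ, (X * C d) ^ i = X ^ i * C (d ^ i) := fun i => by
    rw [(commute_X (C d)).mul_pow, C_pow]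
  have hcoeff : ∀ (p : A[X]) (i : ℕ), (Ψ p).coeff i = p.coeff i * d ^ i := by
    intro p i
    induction p using Polynomial.induction_on' with
    | add p p' hp hp' => rw [map_add, coeff_add, coeff_add, hp, hp', add_mul]
    | monomial j a =>
      rw [← C_mul_X_pow_eq_monomial, map_mul, map_pow, hC, hX, hpow, ← mul_assoc, coeff_mul_C,
        coeff_C_mul_X_pow]
      split_ifs with h
      · rw [h]
      · simp
  have hregpow : ∀ (i : ℕ) (a : A), a * d ^ i = 0 → a = 0 := by
    intro i
    induction i with
    | zero => simp
    | succ i ih => exact fun a h => ih a (hreg _ (by rw [mul_assoc, ← pow_succ, h]))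
  refine ⟨Ψ, (injective_iff_map_eq_zero Ψ).2 fun p hp => Polynomial.ext fun i => ?_, hX, hC⟩
  rw [coeff_zero]
  refine hregpow i _ ?_
  rw [← hcoeff, hp, coeff_zero]

end ScalingPolynomials

section Rows

variable {K : Type*} [Field K] {q : K} {k N : ℕ}

/-- Quantum matrices with fewer rows, extended by zero rows. -/
theorem isQuantumMatrix_zeroRows (q : K) (m N : ℕ) :
    IsQuantumMatrix q fun (i j : Fin N) =>
      if h : i.val < m then QMatrix.x q (⟨i.val, h⟩ : Fin m) j else 0 := by
  have hx := QMatrix.isQuantumMatrix_x q m N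
  constructor
  · intro i j l h
    by_cases hi : i.val < m
    · simp only [dif_pos hi]
      exact hx.row _ _ _ h
    · simp [hi]
  · intro i s j h
    by_cases hs : s.val < m
    · have hi : i.val < m := lt_trans h hs
      simp only [dif_pos hi, dif_pos hs]
      exact hx.col _ _ _ h
    · simp [hs]
  · intro i s j l h h'
    by_cases hi : i.val < m
    · have hs : s.val < m := lt_trans h hi
      simp only [dif_pos hi, dif_pos hs]
      exact hx.anti _ _ _ _ h h'
    · simp [hi]
  · intro i s j l h h'
    by_cases hs : s.val < m
    · have hi : i.val < m := lt_trans h hs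
      simp only [dif_pos hi, dif_pos hs]
      exact hx.diag _ _ _ _ h h'
    · simp [hs]

/-- The product of row factors all of which are `1` except the factor of the first row. -/
theorem prod_ofFn_ite_zero {M : Type*} [Monoid M] {t : ℕ} (ht : 0 < t) (u : M) :
    (List.ofFn fun i : Fin t => if i.val = 0 then u else 1).prod = u := by
  obtain ⟨t, rfl⟩ := Nat.exists_eq_succ_of_ne_zero ht.ne'
  rw [List.ofFn_succ, List.prod_cons]
  simp

theorem commute_ite_one {M : Type*} [Monoid M] {u : M} (hu : ∀ a, Commute u a) {t : ℕ}
    (i : Fin t) (a : M) : Commute (if i.val = 0 then u else 1) a := by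
  split_ifs
  · exact hu a
  · exact Commute.one_left a

theorem prod_reverse_ofFn {M : Type*} [Monoid M] {t : ℕ} (g : Fin t → M) :
    (List.ofFn g).reverse.prod = (List.ofFn fun i => g i.rev).prod := by
  congr 1
  refine List.ext_getElem (by simp) fun i h1 h2 => ?_
  simp only [List.getElem_reverse, List.getElem_ofFn, List.length_ofFn]
  congr 1
  ext
  simp only [Fin.val_rev]
  simp at h2
  omega

theorem permLength_rev_conj {t : ℕ} (σ : Equiv.Perm (Fin t)) :
    permLength ((Fin.revPerm.trans σ).trans Fin.revPerm) = permLength σ := by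
  unfold permLength
  refine Finset.card_bij' (fun p _ => (p.2.rev, p.1.rev)) (fun p _ => (p.2.rev, p.1.rev))
    ?_ ?_ ?_ ?_ <;> simp +contextual

theorem quantumMinor_univ {n t : ℕ} (I : Finset (Fin t)) (J : Finset (Fin n)) (hI : I.card = t)
    (hJ : J.card = t) :
    quantumMinor q I J hI hJ = quantumDet q fun a b => QMatrix.x q a (J.orderEmbOfFin hJ b) := by
  have hI' : I = Finset.univ := Finset.eq_univ_of_card I (by simpa using hI)
  have h : ∀ a, I.orderEmbOfFin hI a = a := fun a =>
    (congrFun (Finset.orderEmbOfFin_unique hI (f := id) (by simp [hI']) strictMono_id) a).symm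
  simp only [quantumMinor, h]

theorem mem_revCompl {L : Finset (Fin N)} {i : Fin N} : i ∈ revCompl L ↔ i.rev ∉ L := by
  simp [revCompl, Finset.mem_map_equiv]

theorem revCompl_revCompl (L : Finset (Fin N)) : revCompl (revCompl L) = L := by
  ext i
  simp [mem_revCompl]

end Rows

section Duality

variable {K : Type*} [Field K] {q : K}

/-- A quantum minor on the first rows of the reversed, transposed adjugate of the generic quantum
matrix is, up to a power of `-q`, a power of the quantum determinant times a quantum minor on the
first rows of the generic quantum matrix. -/
theorem quantumDet_mul_rev_adjugate (hq : q ≠ 0) {k m N : ℕ} (hkm : k + m = N)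
    {A : Type*} [Ring A] [Algebra K A] {x y : Fin N → Fin N → A} (hx : IsQuantumMatrix q x)
    (hyx : ∀ i j, ∑ l, y i l * x l j = if i = j then quantumDet q x else 0)
    (hD : ∀ i j, Commute (quantumDet q x) (y i j))
    (hz : IsQuantumMatrix q fun i j : Fin N => y j.rev i.rev)
    (L : Finset (Fin N)) (hL : L.card = k) (hL' : (revCompl L).card = m) :
    quantumDet q x * (((-q) ^ (k * m + ∑ i : Fin k, (i : ℕ)) *
        ∏ a : Fin k, ((-q) ^ (L.orderEmbOfFin hL a).rev.val)⁻¹) •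
      quantumDet q fun a b : Fin k =>
        y (L.orderEmbOfFin hL b).rev (Fin.castLE (by omega : k ≤ N) a).rev)
      = quantumDet q x ^ k * quantumDet q fun a b : Fin m =>
        x (Fin.castLE (by omega : m ≤ N) a) ((revCompl L).orderEmbOfFin hL' b) := by
  have hq' : -q ≠ 0 := neg_ne_zero.2 hq
  have hk : k ≤ N := by omega
  have hm : m ≤ N := by omega
  set l := L.orderEmbOfFin hL with hl
  set e := (revCompl L).orderEmbOfFin hL' with he
  set b : Fin k → Fin N := fun i => (l i.rev).rev with hb
  set s : Fin k → Fin N := fun i => (Fin.castLE hk i.rev).rev with hs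
  set r : Fin m → Fin N := Fin.castLE hm with hr
  have hbm : StrictMono b := fun i j hij =>
    Fin.rev_lt_rev.2 (l.strictMono (Fin.rev_lt_rev.2 hij))
  have hsm : StrictMono s := fun i j hij =>
    Fin.rev_lt_rev.2 (Fin.rev_lt_rev.2 hij : j.rev < i.rev)
  have hrm : StrictMono r := fun i j hij => hij
  have hbe : ∀ z, z ∈ Set.range e ↔ z ∉ Set.range b := by
    intro z
    rw [he, Finset.range_orderEmbOfFin, Finset.mem_coe, mem_revCompl, not_iff_not,
      ← Finset.mem_coe, ← Finset.range_orderEmbOfFin L hL, ← hl]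
    constructor
    · rintro ⟨i, hi⟩
      exact ⟨i.rev, by simp [hb, hi]⟩
    · rintro ⟨i, hi⟩
      exact ⟨i.rev, by simp [← hi, hb]⟩
  have hsr : ∀ z, z ∈ Set.range s ↔ z ∉ Set.range r := by
    intro z
    have h1 : z ∈ Set.range r ↔ z.val < m :=
      ⟨by rintro ⟨i, rfl⟩; exact i.isLt, fun h => ⟨⟨z, h⟩, rfl⟩⟩
    rw [h1, not_lt]
    constructor
    · rintro ⟨i, rfl⟩
      simp only [hs, Fin.val_rev, Fin.val_castLE]
      omega
    · intro h
      refine ⟨⟨z.val - m, by omega⟩, ?_⟩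
      ext
      simp only [hs, Fin.val_rev, Fin.val_castLE]
      omega
  -- `s` lists the last `k` rows and `r` the first `m` rows.
  have hcross : crossCount s r = k * m := by
    unfold crossCount
    rw [Finset.filter_true_of_mem]
    · simp
    · rintro ⟨i, j⟩ -
      simp only [hs, hr, Fin.lt_def, Fin.val_rev, Fin.val_castLE]
      omega
  have hcross' := crossCount_add_sum hbm e.strictMono hbe
  have hbsum : ∑ i, (b i : ℕ) = ∑ a, ((l a).rev : ℕ) :=
    Equiv.sum_comp Fin.revPerm fun a => ((l a).rev : ℕ)
  have hJ := quantumDet_mul_adjugate_minor hq hx hyx hD hkm hbm e.strictMono hbe hsm hrm hsr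
  -- Conjugating `σ` with the reversal of the order turns the reversed words into the column expansion.
  have hminor : ∑ σ : Equiv.Perm (Fin k), (-q) ^ permLength σ •
      (List.ofFn fun i => y (b i) (s (σ i))).reverse.prod
      = quantumDet q fun a b : Fin k => y (l b).rev (Fin.castLE hk a).rev := by
    rw [← quantumDet_transpose (x := fun a b : Fin k => y (l b).rev (Fin.castLE hk a).rev)
      (hz.submatrix (f := Fin.castLE hk) (g := l) (fun _ _ h => h) fun _ _ h => l.strictMono h)]
    unfold quantumDet
    refine Fintype.sum_bijective
      (fun σ : Equiv.Perm (Fin k) => (Fin.revPerm.trans σ).trans Fin.revPerm) ?_ _ _ fun σ => ?_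
    · refine Function.Involutive.bijective fun σ => ?_
      ext1 i
      simp
    · rw [permLength_rev_conj, prod_reverse_ofFn]
      simp [hb, hs]
  rw [hminor, hcross, mul_smul_comm, mul_smul_comm] at hJ
  have hscalar : (∏ a : Fin k, ((-q) ^ (l a).rev.val)⁻¹)
      = ((-q) ^ (crossCount b e + ∑ i : Fin k, (i : ℕ)))⁻¹ := by
    rw [hcross', hbsum, Finset.prod_inv_distrib, Finset.prod_pow_eq_pow_sum]
  rw [hscalar, mul_smul_comm]
  have h1 : (-q) ^ (k * m + ∑ i : Fin k, (i : ℕ))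
      * ((-q) ^ (crossCount b e + ∑ i : Fin k, (i : ℕ)))⁻¹
      = ((-q) ^ crossCount b e)⁻¹ * (-q) ^ (k * m) := by
    rw [pow_add, pow_add]
    field_simp
  rw [h1, mul_smul, hJ, smul_smul, inv_mul_cancel₀ (pow_ne_zero _ hq'), one_smul]

/-- The quantum Plücker coordinates generate: the only set of `k` rows is the set of all rows. -/
theorem quantumGrassmannian_algHom_ext {k n : ℕ} {B : Type*} [Semiring B] [Algebra K B]
    {f g : quantumGrassmannian q k n →ₐ[K] B}
    (h : ∀ (L : Finset (Fin n)) (hL : L.card = k),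
      f (quantumPlucker q L hL) = g (quantumPlucker q L hL)) : f = g := by
  refine AlgHom.adjoin_ext ?_
  rintro _ ⟨I, J, hI, hJ, rfl⟩
  have hI' : I = Finset.univ := Finset.eq_univ_of_card I (by simpa using hI)
  subst hI'
  exact h J hJ

/-- The duality map in one direction, stated for `k + m = N` so that it may be applied to `(k, m)` and
to `(m, k)`. -/
theorem exists_quantumGrassmannian_algHom (hq : q ≠ 0) {k m N : ℕ} (hkm : k + m = N) (hk : 0 < k)
    (hm : 0 < m) :
    ∃ φ : quantumGrassmannian q k N →ₐ[K] quantumGrassmannian q m N,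
      ∀ (L : Finset (Fin N)) (hL : L.card = k) (hL' : (revCompl L).card = m),
        φ (quantumPlucker q L hL) = quantumPlucker q (revCompl L) hL' := by
  have := QMatrix.noZeroDivisors hq N N
  set x : Fin N → Fin N → QMatrix q N N := fun i j => QMatrix.x q i j with hxdef
  have hx : IsQuantumMatrix q x := QMatrix.isQuantumMatrix_x q N N
  obtain ⟨y, hxy, hyx⟩ := exists_adjugate hq hx
  set D := quantumDet q x with hDdef
  have hD : ∀ u, Commute D u := commute_quantumDet_x hq N
  have hD0 : D ≠ 0 := quantumDet_x_ne_zero q N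
  have hz := (hx.op_of_adjugate hq (fun u v h => mul_left_cancel₀ hD0 h) hD hxy hyx).rev_of_op
  have hkN : k ≤ N := by omega
  have hmN : m ≤ N := by omega
  have hCC : ∀ {d : QMatrix q N N}, (∀ u, Commute d u) →
      ∀ p : (QMatrix q N N)[X], Commute (X * C d) p := by
    intro d hd p
    refine (commute_X p).mul_left ?_
    ext i
    rw [coeff_C_mul, coeff_mul_C, (hd _).eq]
  have hDk : ∀ u, Commute (D ^ (k - 1)) u := fun u => (hD u).pow_left _
  -- The scalar that is left over from the Jacobi identity, to be absorbed by the first row.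
  set ρ : QMatrix q N N :=
    algebraMap K _ ((-q) ^ (k * m + ∑ i : Fin k, (i : ℕ))) with hρdef
  have hρ : ∀ u, Commute ρ u := fun u => Algebra.commutes _ u
  -- The two maps into the polynomial ring; the variable records the degree in the coordinates.
  have hf := (((hz.submatrix (f := Fin.castLE hkN) (g := id) (fun _ _ h => h)
      fun _ _ h => h).smul_col fun j => ((-q) ^ j.rev.val)⁻¹).map
      (CAlgHom (R := K) (A := QMatrix q N N))).central_mul
      (fun i : Fin k => if i.val = 0 then X * C ρ else 1) (commute_ite_one (hCC hρ))
  have hγ := ((hx.submatrix (f := Fin.castLE hmN) (g := id) (fun _ _ h => h)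
      fun _ _ h => h).map (CAlgHom (R := K) (A := QMatrix q N N))).central_mul
      (fun i : Fin m => if i.val = 0 then (X : (QMatrix q N N)[X]) else 1) (commute_ite_one commute_X)
  obtain ⟨Ψ, hΨinj, hΨX, hΨC⟩ := exists_algHom_X_mul (K := K) (D ^ (k - 1)) hDk
    fun a ha => (mul_eq_zero.1 ha).resolve_right (pow_ne_zero _ hD0)
  let f : QMatrix q k N →ₐ[K] (QMatrix q N N)[X] := QMatrix.lift hf
  let γ : QMatrix q m N →ₐ[K] (QMatrix q N N)[X] := QMatrix.lift hγ
  let g : QMatrix q m N →ₐ[K] (QMatrix q N N)[X] := Ψ.comp γ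
  have hγinj : Function.Injective γ := by
    let ev : (QMatrix q N N)[X] →ₐ[K] QMatrix q N N :=
      eval₂AlgHom (AlgHom.id K _) 1 fun a => Commute.one_right _
    let ret : QMatrix q N N →ₐ[K] QMatrix q m N :=
      QMatrix.lift (isQuantumMatrix_zeroRows q m N)
    have h : (ret.comp ev).comp γ = AlgHom.id K _ := QMatrix.algHom_ext' fun i j => by
      have hevC : ∀ a, ev (C a) = a := fun a => eval₂_C _ _
      have hevX : ev X = 1 := eval₂_X _ _
      have hev : ev (γ (QMatrix.x q i j)) = x (Fin.castLE hmN i) j := by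
        simp only [γ, QMatrix.lift_x, map_mul]
        have : ev (CAlgHom (R := K) (x (Fin.castLE hmN i) (id j))) = x (Fin.castLE hmN i) j :=
          hevC _
        rw [this]
        split_ifs <;> simp [hevX]
      rw [AlgHom.comp_apply, AlgHom.comp_apply, hev]
      simp [ret, hxdef]
    intro u v huv
    have := congrArg (ret.comp ev) huv
    rwa [← AlgHom.comp_apply, ← AlgHom.comp_apply, h] at this
  have hginj : Function.Injective g := hΨinj.comp hγinj
  have hfL : ∀ (L : Finset (Fin N)) (hL : L.card = k),
      f (quantumMinor q Finset.univ L (Finset.card_fin k) hL)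
        = X * C (((-q) ^ (k * m + ∑ i : Fin k, (i : ℕ)) *
          ∏ a : Fin k, ((-q) ^ (L.orderEmbOfFin hL a).rev.val)⁻¹) •
          quantumDet q fun a b : Fin k =>
            y (L.orderEmbOfFin hL b).rev (Fin.castLE hkN a).rev) := by
    intro L hL
    rw [quantumMinor_univ]
    refine (map_quantumDet (A := QMatrix q k N) (B := (QMatrix q N N)[X]) f _).trans ?_
    simp only [f, QMatrix.lift_x]
    rw [quantumDet_central_mul _ (commute_ite_one (hCC hρ)), prod_ofFn_ite_zero hk,
      ← map_quantumDet (B := (QMatrix q N N)[X])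
        (CAlgHom (R := K) (A := QMatrix q N N)), quantumDet_smul
        (fun b => ((-q) ^ (L.orderEmbOfFin hL b).rev.val)⁻¹), mul_smul, mul_assoc, hρdef,
      Algebra.smul_def ((-q) ^ (k * m + ∑ i : Fin k, (i : ℕ))), C_mul]
    rfl
  have hgL : ∀ (L : Finset (Fin N)) (hL : L.card = m),
      g (quantumMinor q Finset.univ L (Finset.card_fin m) hL)
        = X * C (D ^ (k - 1) * quantumDet q fun a b : Fin m =>
            x (Fin.castLE hmN a) (L.orderEmbOfFin hL b)) := by
    intro L hL
    rw [quantumMinor_univ, AlgHom.comp_apply]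
    refine (congrArg Ψ (map_quantumDet (A := QMatrix q m N) (B := (QMatrix q N N)[X]) γ _)).trans ?_
    simp only [γ, QMatrix.lift_x]
    rw [quantumDet_central_mul _ (commute_ite_one commute_X), prod_ofFn_ite_zero hm,
      ← map_quantumDet (B := (QMatrix q N N)[X])
        (CAlgHom (R := K) (A := QMatrix q N N)), map_mul, hΨX]
    rw [C_mul, ← mul_assoc]
    congr 1
    exact hΨC _
  have hfg : ∀ (L : Finset (Fin N)) (hL : L.card = k) (hL' : (revCompl L).card = m),
      f (quantumMinor q Finset.univ L (Finset.card_fin k) hL)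
        = g (quantumMinor q Finset.univ (revCompl L) (Finset.card_fin m) hL') := by
    intro L hL hL'
    rw [hfL, hgL]
    congr 2
    refine mul_left_cancel₀ hD0 ?_
    rw [quantumDet_mul_rev_adjugate hq hkm hx hyx (fun _ _ => hD _) hz L hL hL', ← mul_assoc,
      ← pow_succ', Nat.sub_add_cancel hk]
  -- The duality map is `f` followed by the inverse of `g`, restricted to the grassmannians.
  let g' := g.comp (quantumGrassmannian q m N).val
  have hg'inj : Function.Injective g' := hginj.comp Subtype.val_injective
  let f' := f.comp (quantumGrassmannian q k N).val
  have hrange : ∀ u, f' u ∈ g'.range := by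
    have hle : quantumGrassmannian q k N ≤ g'.range.comap f := by
      refine Algebra.adjoin_le ?_
      rintro _ ⟨I, J, hI, hJ, rfl⟩
      have hI' : I = Finset.univ := Finset.eq_univ_of_card I (by simpa using hI)
      subst hI'
      have hJ' : (revCompl J).card = m := by rw [card_revCompl hJ]; omega
      exact ⟨quantumPlucker q (revCompl J) hJ', (hfg J hJ hJ').symm⟩
    exact fun u => hle u.2
  refine ⟨(AlgEquiv.ofInjective g' hg'inj).symm.toAlgHom.comp (f'.codRestrict g'.range hrange),
    fun L hL hL' => ?_⟩
  rw [AlgHom.comp_apply]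
  refine (AlgEquiv.symm_apply_eq _).2 (Subtype.ext ?_)
  exact hfg L hL hL'

end Duality

theorem proposition3p4 {K : Type*} [Field K] (q : K) (hq0 : q ≠ 0)
    (hq : ∀ m : ℕ, 0 < m → q ^ m ≠ 1) (k n : ℕ) (hk : 0 < k) (hkn : k < n) :
    ∃ φ : quantumGrassmannian q k n ≃ₐ[K] quantumGrassmannian q (n - k) n,
      ∀ (L : Finset (Fin n)) (hL : L.card = k),
        φ (quantumPlucker q L hL) = quantumPlucker q (revCompl L) (card_revCompl hL) := by
  obtain ⟨φ, hφ⟩ := exists_quantumGrassmannian_algHom hq0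
    (show k + (n - k) = n by omega) hk (by omega)
  obtain ⟨ψ, hψ⟩ := exists_quantumGrassmannian_algHom hq0
    (show (n - k) + k = n by omega) (by omega) hk
  have hcongr : ∀ {t : ℕ} {L L' : Finset (Fin n)} (h : L = L') (hL : L.card = t)
      (hL' : L'.card = t), quantumPlucker q L hL = quantumPlucker q L' hL' := by
    rintro t L _ rfl _ _
    rfl
  refine ⟨AlgEquiv.ofAlgHom φ ψ ?_ ?_, fun L hL => hφ L hL _⟩
  · refine quantumGrassmannian_algHom_ext fun L hL => ?_
    have hL' : (revCompl L).card = k := by rw [card_revCompl hL]; omega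
    rw [AlgHom.comp_apply, hψ L hL hL', hφ _ hL' (by rwa [revCompl_revCompl])]
    exact hcongr (revCompl_revCompl L) _ _
  · refine quantumGrassmannian_algHom_ext fun L hL => ?_
    rw [AlgHom.comp_apply, hφ L hL (card_revCompl hL), hψ _ _ (by rwa [revCompl_revCompl])]
    exact hcongr (revCompl_revCompl L) _ _
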